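/- Let $d,m,n\ge 0$ be integers, let $\mathbb A=\{a_1,\dots,a_d\}$ be a linearly independent set of vectors in $\mathbb R^d$, and let $A\in\mathbb R^{d\times d}$ be the matrix whose rows are $a_1^\top,\dots,a_d^\top$. Let $M=[p_{ij}]\in(\mathbb C[\xi_1,\dots,\xi_d,\tau])^{m\times n}$ be a polynomial matrix. A distribution $T$ on $\mathbb R^d$ is called $\mathbb A$-periodic if $\langle T,\psi(\cdot+a_k)\rangle=\langle T,\psi\rangle$ for all $\psi\in\mathcal D(\mathbb R^d)$ and $k=1,\dots,d$. Let $\mathcal D'_{\mathbb A}(\mathbb R^{d+1})$ be the set of all complex distributions $w$ on $\mathbb R^{d+1}=\mathbb R^d\times\mathbb R$ (with variables $(x,t)$) such that for every $\varphi\in\mathcal D(\mathbb R)$ the distribution $\psi\mapsto\langle w,\psi\otimes\varphi\rangle$ on $\mathbb R^d$ is $\mathbb A$-periodic. The behaviour of $M$ is $$\mathfrak B(M)=\Big\{w\in\big(\mathcal D'_{\mathbb A}(\mathbb R^{d+1})\big)^n:\ \sum_{j=1}^n p_{ij}\Big(\frac{\partial}{\partial x_1},\dots,\frac{\partial}{\partial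 x_d},\frac{\partial}{\partial t}\Big)w_j=0\ \text{ for } i=1,\dots,m\Big\}.$$ It is called autonomous if the only $w\in\mathfrak B(M)$ whose restriction to the open half space $\{t<0\}$ vanishes is $w=0$. Then the following two statements are equivalent: 1. $\mathfrak B(M)$ is autonomous. 2. For all $v\in A^{-1}\mathbb Z^d$, $\displaystyle\max_{t\in\mathbb C}\ \operatorname{rank} M(2\pi i v,t)=n$. -/

import Mathlib

open scoped Distributions LineDeriv

noncomputable section

namespace PeriodicBehaviour

/-! ### Spaces of distributions -/

/-- The space variables: `ℝ^d`. (Only the topological vector space structure matters below.) -/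
abbrev Space (d : ℕ) : Type := Fin d → ℝ

/-- `ℝ^{d+1}`, whose points are pairs `(x, t)` with `x ∈ ℝ^d` and `t ∈ ℝ`. -/
abbrev SpaceTime (d : ℕ) : Type := Space d × ℝ

/-- Real-valued test functions on the whole of `E`. -/
abbrev Test (E : Type) [NormedAddCommGroup E] [NormedSpace ℝ E] : Type :=
  𝓓((⊤ : TopologicalSpace.Opens E), ℝ)

/-- Complex-valued distributions on the whole of `E`, i.e. continuous `ℝ`-linear maps from the
real-valued test functions to `ℂ`. -/
abbrev Distr (E : Type) [NormedAddCommGroup E] [NormedSpace ℝ E] : Type :=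
  𝓓'((⊤ : TopologicalSpace.Opens E), ℂ)

/-! ### Translations and periodic distributions on `ℝ^d` -/

section Translation

/-- The compact set `K - a`. -/
def translateCompacts {E : Type} [NormedAddCommGroup E] (a : E)
    (K : TopologicalSpace.Compacts E) : TopologicalSpace.Compacts E :=
  K.map (fun x => x - a) (continuous_id.sub continuous_const)

lemma mem_translateCompacts {E : Type} [NormedAddCommGroup E] {a : E}
    {K : TopologicalSpace.Compacts E} {x : E} :
    x ∈ (translateCompacts a K : Set E) ↔ x + a ∈ K := by
  simp only [translateCompacts, TopologicalSpace.Compacts.coe_map, Set.mem_image, SetLike.mem_coe]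
  constructor
  · rintro ⟨y, hy, rfl⟩
    simpa using hy
  · intro h
    exact ⟨x + a, h, by simp⟩

variable {E : Type} [NormedAddCommGroup E] [NormedSpace ℝ E]

/-- The translated test function `φ(· + a)`. -/
def translateFun (a : E) (φ : Test E) : Test E where
  toFun x := φ (x + a)
  contDiff' := φ.contDiff.comp (contDiff_id.add contDiff_const)
  hasCompactSupport' := φ.hasCompactSupport.comp_homeomorph (Homeomorph.addRight a)
  tsupport_subset' := by simp

/-- Translation `φ ↦ φ(· + a)` as a continuous linear map on test functions. -/
def translateTest (a : E) : Test E →L[ℝ] Test E :=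
  TestFunction.limitCLM ℝ (translateFun a)
    (fun K _ => (TestFunction.ofSupportedInCLM ℝ (K := translateCompacts a K)
        (Ω := (⊤ : TopologicalSpace.Opens E)) (by simp)).comp
      (ContDiffMapSupportedIn.mkCLM ℝ (fun f x => f (x + a))
        (fun _ _ _ => rfl) (fun _ _ _ => rfl)
        (fun f => f.contDiff.comp (contDiff_id.add contDiff_const))
        (fun f x hx => f.zero_on_compl (fun h => hx (mem_translateCompacts.2 h)))
        (fun i hi => ⟨{i}, 1, zero_le_one, fun f x _ => by
          rw [iteratedFDeriv_comp_add_right, one_mul, Finset.sup_singleton]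
          exact ContDiffMapSupportedIn.norm_iteratedFDeriv_apply_le_seminorm ℝ hi⟩)))
    (fun _ _ _ => rfl)

@[simp]
lemma translateTest_apply (a : E) (φ : Test E) (x : E) : translateTest a φ x = φ (x + a) := rfl

/-- The translation `S_a` of distributions: `⟨S_a T, φ⟩ = ⟨T, φ(· + a)⟩`. -/
def translateDistr (a : E) (T : Distr E) : Distr E :=
  (translateTest a).precompCompactConvergenceCLM ℂ T

@[simp]
lemma translateDistr_apply (a : E) (T : Distr E) (φ : Test E) :
    translateDistr a T φ = T (translateTest a φ) := rfl

end Translation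

/-- The space `𝓓'_𝔸(ℝ^d)` of the distributions `T` on `ℝ^d` such that `S_{a_k} T = T` for all
`k`. -/
def periodicDistr {d : ℕ} (a : Fin d → Space d) : Set (Distr (Space d)) :=
  {T | ∀ k, translateDistr (a k) T = T}

/-! ### Distributions on `ℝ^{d+1}` that are periodic in the space variables -/

/-- The tensor product `(ψ ⊗ φ)(x, t) = ψ(x) φ(t)` of two test functions. -/
def tensorFun {d : ℕ} (φ : Test ℝ) (ψ : Test (Space d)) : Test (SpaceTime d) where
  toFun p := ψ p.1 * φ p.2
  contDiff' := (ψ.contDiff.comp contDiff_fst).mul (φ.contDiff.comp contDiff_snd)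
  hasCompactSupport' := by
    refine HasCompactSupport.intro
      (ψ.hasCompactSupport.isCompact.prod φ.hasCompactSupport.isCompact) fun p hp => ?_
    rcases not_and_or.1 hp with h | h
    · simp [image_eq_zero_of_notMem_tsupport h]
    · simp [image_eq_zero_of_notMem_tsupport h]
  tsupport_subset' := by simp

/-- The compact set `K × supp φ`. -/
def tensorCompacts {d : ℕ} (φ : Test ℝ) (K : TopologicalSpace.Compacts (Space d)) :
    TopologicalSpace.Compacts (SpaceTime d) :=
  K ×ˢ ⟨tsupport φ, φ.hasCompactSupport⟩

lemma norm_iteratedFDeriv_comp_clm_le {E G : Type} [NormedAddCommGroup E] [NormedSpace ℝ E]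
    [NormedAddCommGroup G] [NormedSpace ℝ G] {f : E → ℝ} (hf : ContDiff ℝ (⊤ : ℕ∞) f)
    (L : G →L[ℝ] E) (hL : ‖L‖ ≤ 1) (i : ℕ) (p : G) :
    ‖iteratedFDeriv ℝ i (fun q => f (L q)) p‖ ≤ ‖iteratedFDeriv ℝ i f (L p)‖ := by
  have h := L.iteratedFDeriv_comp_right hf p (i := i) (mod_cast le_top)
  change ‖iteratedFDeriv ℝ i (f ∘ L) p‖ ≤ _
  rw [h]
  refine (ContinuousMultilinearMap.norm_compContinuousLinearMap_le _ _).trans ?_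
  refine mul_le_of_le_one_right (norm_nonneg _) ?_
  exact Finset.prod_le_one (fun _ _ => norm_nonneg _) (fun _ _ => hL)

lemma norm_iteratedFDeriv_tensor_le {d : ℕ} (φ : Test ℝ) (K : TopologicalSpace.Compacts (Space d))
    (i : ℕ) : ∃ (s : Finset ℕ) (C : ℝ), 0 ≤ C ∧ ∀ (f : 𝓓_{K}(Space d, ℝ)) (p : SpaceTime d),
      ‖iteratedFDeriv ℝ i (fun q : SpaceTime d => f q.1 * φ q.2) p‖ ≤
        C * (s.sup fun j => ContDiffMapSupportedIn.seminorm ℝ (Space d) ℝ ⊤ K j) f := by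
  let L : TopologicalSpace.Compacts ℝ := ⟨tsupport φ, φ.hasCompactSupport⟩
  let φL : 𝓓_{L}(ℝ, ℝ) := .of_support_subset φ.contDiff subset_closure
  let N (j : ℕ) := ContDiffMapSupportedIn.seminorm ℝ (Space d) ℝ ⊤ K j
  let c (j : ℕ) : ℝ := ContDiffMapSupportedIn.seminorm ℝ ℝ ℝ ⊤ L j φL
  have hc (j : ℕ) : 0 ≤ c j := apply_nonneg _ _
  refine ⟨Finset.range (i + 1), ∑ j ∈ Finset.range (i + 1), (i.choose j : ℝ) * c (i - j),
    Finset.sum_nonneg fun j _ => mul_nonneg (Nat.cast_nonneg _) (hc _), fun f p => ?_⟩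
  refine (norm_iteratedFDeriv_mul_le (𝕜 := ℝ) (N := (⊤ : ℕ∞)) (f.contDiff.comp contDiff_fst)
    (φ.contDiff.comp contDiff_snd) p (n := i) (mod_cast le_top)).trans ?_
  rw [Finset.sum_mul]
  refine Finset.sum_le_sum fun j hj => ?_
  have h1 : ‖iteratedFDeriv ℝ j (fun q : SpaceTime d => f q.1) p‖ ≤
      ((Finset.range (i + 1)).sup N) f := by
    refine (norm_iteratedFDeriv_comp_clm_le f.contDiff (ContinuousLinearMap.fst ℝ (Space d) ℝ)
      (ContinuousLinearMap.norm_fst_le ..) j p).trans ?_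
    refine (ContDiffMapSupportedIn.norm_iteratedFDeriv_apply_le_seminorm_top ℝ).trans ?_
    exact (Finset.le_sup (f := N) hj) f
  have h2 : ‖iteratedFDeriv ℝ (i - j) (fun q : SpaceTime d => φ q.2) p‖ ≤ c (i - j) := by
    refine (norm_iteratedFDeriv_comp_clm_le φ.contDiff (ContinuousLinearMap.snd ℝ (Space d) ℝ)
      (ContinuousLinearMap.norm_snd_le ..) (i - j) p).trans ?_
    exact ContDiffMapSupportedIn.norm_iteratedFDeriv_apply_le_seminorm_top ℝ (f := φL)
  calc _ ≤ (i.choose j : ℝ) * ((Finset.range (i + 1)).sup N) f * c (i - j) := by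
        refine mul_le_mul (mul_le_mul_of_nonneg_left h1 (Nat.cast_nonneg _)) h2 (norm_nonneg _) ?_
        exact mul_nonneg (Nat.cast_nonneg _) (apply_nonneg _ _)
    _ = _ := by ring

/-- For fixed `φ`, the linear map `ψ ↦ ψ ⊗ φ` on the test functions supported in `K`. -/
def tensorSupportedInLM {d : ℕ} (φ : Test ℝ) (K : TopologicalSpace.Compacts (Space d)) :
    𝓓_{K}(Space d, ℝ) →ₗ[ℝ] 𝓓_{tensorCompacts φ K}(SpaceTime d, ℝ) where
  toFun f :=
    { toFun := fun p => f p.1 * φ p.2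
      contDiff' := (f.contDiff.comp contDiff_fst).mul (φ.contDiff.comp contDiff_snd)
      zero_on_compl' := fun p hp => by
        have hp' : ¬ (p.1 ∈ (K : Set (Space d)) ∧ p.2 ∈ tsupport φ) := hp
        rcases not_and_or.1 hp' with h | h
        · have := f.zero_on_compl h
          simp_all
        · simp [image_eq_zero_of_notMem_tsupport h] }
  map_add' _ _ := by
    ext p
    exact add_mul _ _ _
  map_smul' _ _ := by
    ext p
    exact mul_assoc _ _ _

/-- For fixed `φ`, the map `ψ ↦ ψ ⊗ φ` on the test functions supported in `K`. -/
def tensorSupportedIn {d : ℕ} (φ : Test ℝ) (K : TopologicalSpace.Compacts (Space d)) :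
    𝓓_{K}(Space d, ℝ) →L[ℝ] 𝓓_{tensorCompacts φ K}(SpaceTime d, ℝ) where
  toLinearMap := tensorSupportedInLM φ K
  cont := show Continuous (tensorSupportedInLM φ K) by
    refine WithSeminorms.continuous_of_isBounded (ContDiffMapSupportedIn.withSeminorms ℝ ..)
      (ContDiffMapSupportedIn.withSeminorms ℝ ..) _ (.of_real fun i => ?_)
    obtain ⟨s, C, hC, h⟩ := norm_iteratedFDeriv_tensor_le φ K i
    exact ⟨s, C, fun f => (ContDiffMapSupportedIn.seminorm_le_iff ℝ
      (mul_nonneg hC (apply_nonneg _ _)) i _).2 fun _ p _ => h f p⟩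

/-- For fixed `φ`, the map `ψ ↦ ψ ⊗ φ` as a continuous linear map on test functions. -/
def tensorTest {d : ℕ} (φ : Test ℝ) : Test (Space d) →L[ℝ] Test (SpaceTime d) :=
  TestFunction.limitCLM ℝ (tensorFun φ)
    (fun K _ => (TestFunction.ofSupportedInCLM ℝ (K := tensorCompacts φ K)
        (Ω := (⊤ : TopologicalSpace.Opens (SpaceTime d))) (by simp)).comp (tensorSupportedIn φ K))
    (fun _ _ _ => rfl)

@[simp]
lemma tensorTest_apply {d : ℕ} (φ : Test ℝ) (ψ : Test (Space d)) (p : SpaceTime d) :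
    tensorTest φ ψ p = ψ p.1 * φ p.2 := rfl

/-- The value at `φ ∈ 𝓓(ℝ)` of the vector-valued distribution attached to `w ∈ 𝓓'(ℝ^{d+1})`:
the distribution `ψ ↦ ⟨w, ψ ⊗ φ⟩` on `ℝ^d`. -/
def slice {d : ℕ} (w : Distr (SpaceTime d)) (φ : Test ℝ) : Distr (Space d) :=
  (tensorTest φ).precompCompactConvergenceCLM ℂ w

@[simp]
lemma slice_apply {d : ℕ} (w : Distr (SpaceTime d)) (φ : Test ℝ) (ψ : Test (Space d)) :
    slice w φ ψ = w (tensorTest φ ψ) := rfl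

/-- The space `𝓓'_𝔸(ℝ^{d+1})` of the distributions on `ℝ^{d+1}` that are periodic in the space
variables, with the periods `a_1, …, a_d`. -/
def spatiallyPeriodicDistr {d : ℕ} (a : Fin d → Space d) : Set (Distr (SpaceTime d)) :=
  {w | ∀ φ : Test ℝ, slice w φ ∈ periodicDistr a}

/-! ### Constant coefficient differential operators

A polynomial in `ξ_1, …, ξ_d, τ` is an element of `MvPolynomial (Fin (d + 1)) ℂ`, the last variable
being `τ`. -/

/-- The coordinate directions of `ℝ^{d+1}`: the `k`-th coordinate vector of `ℝ^d` for `k < d`, and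
the time direction for the last index. -/
def direction {d : ℕ} : Fin (d + 1) → SpaceTime d :=
  Fin.snoc (α := fun _ => SpaceTime d) (fun k => (Pi.single k 1, 0)) (0, 1)

/-- `(∂/∂x_1)^{α_1} ⋯ (∂/∂x_d)^{α_d} (∂/∂t)^{α_{d+1}}` on distributions. -/
def partialDeriv {d : ℕ} (α : Fin (d + 1) →₀ ℕ) :
    Distr (SpaceTime d) →L[ℝ] Distr (SpaceTime d) :=
  (List.ofFn fun i : Fin (d + 1) =>
    LineDeriv.lineDerivOpCLM ℝ (Distr (SpaceTime d)) (direction i) ^ α i).prod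

/-- `p(∂/∂x_1, …, ∂/∂x_d, ∂/∂t) w`. -/
def diffOp {d : ℕ} (p : MvPolynomial (Fin (d + 1)) ℂ) (w : Distr (SpaceTime d)) :
    Distr (SpaceTime d) :=
  ∑ α ∈ p.support, p.coeff α • partialDeriv α w

/-! ### Behaviours -/

/-- The behaviour of `M` in `W`: all `w ∈ W^n` with `M(∂/∂x_1, …, ∂/∂x_d, ∂/∂t) w = 0`. -/
def behaviour {d m n : ℕ} (W : Set (Distr (SpaceTime d)))
    (M : Matrix (Fin m) (Fin n) (MvPolynomial (Fin (d + 1)) ℂ)) :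
    Set (Fin n → Distr (SpaceTime d)) :=
  {w | (∀ j, w j ∈ W) ∧ ∀ i, ∑ j, diffOp (M i j) (w j) = 0}

/-- A behaviour is autonomous if its only element whose restriction to `t < 0` vanishes is `0`. -/
def IsAutonomous {d n : ℕ} (B : Set (Fin n → Distr (SpaceTime d))) : Prop :=
  ∀ w ∈ B, (∀ j, Distribution.IsVanishingOn (w j) {p : SpaceTime d | p.2 < 0}) → w = 0

/-- The complex matrix `M(ζ_1, …, ζ_d, t)`. -/
def evalMatrix {d m n : ℕ} (M : Matrix (Fin m) (Fin n) (MvPolynomial (Fin (d + 1)) ℂ))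
    (ζ : Fin d → ℂ) (t : ℂ) : Matrix (Fin m) (Fin n) ℂ :=
  M.map (MvPolynomial.eval (Fin.snoc (α := fun _ => ℂ) ζ t))

end PeriodicBehaviour

end

/-!
The behaviour is decomposed into Fourier modes in space, which reduces the statement to systems of
ordinary differential equations in time.

Let `w` be spatially periodic. For test functions `ψ` of space and `φ` of time, the function
`y ↦ ⟨w, ψ(· + ∑ y_i a_i) ⊗ φ⟩` on `ℝ^d` is continuous and has period `1` in every coordinate. Its
Fourier coefficients, seen as functionals of `φ`, are the modes of `w` (`fourierFunctional`). If all
of them vanish, then so does `w`, because tensor products are dense in the test functions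
(`eq_zero_of_fourierFunctional_eq_zero`, `distr_eq_zero_of_tensorTest`). Passing to a mode turns
`∂/∂x` into multiplication by `2 π i v`, for some `v ∈ A⁻¹ ℤ^d`, and `∂/∂t` into the derivative `D`
of functionals, hence the equations of the behaviour into `M(2 π i v, D) u = 0` (`map_diffOp`).

If `M(2 π i v, t)` has rank `n` for some `t`, there are a polynomial matrix `B` and a polynomial
`q ≠ 0` with `B · M(2 π i v, τ) = q · 1` (`exists_mul_eq_smul_one`), and so `q(D) u_j = 0` for all
`j`. A functional that solves such an equation and vanishes on the test functions supported in
`t < 0` is zero (`VanishesOnPast.eq_zero_of_aeval_eq_zero`): for linear `q` every test function is,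
up to one supported in `t < 0`, in the image of the transposed operator, and the general case
follows by factoring `q`. No continuity of the functional is needed. This proves autonomy.

If the rank is less than `n` for all `t`, there is a polynomial vector `q ≠ 0` in the kernel of
`M(2 π i v, τ)` (`exists_mulVec_eq_zero_of_rank_ne`). Let `u = exp (2 π i v · x) θ(t)`, with a
smooth `θ` that vanishes exactly for `t ≤ 0`. Then `w_j = q_j(∂/∂t) u` defines an element of the
behaviour that vanishes for `t < 0`. It is not zero: `q_j ≠ 0` for some `j`, and `q_j(∂/∂t) u = 0`
would imply `u = 0` by the uniqueness just described.

The analytic tool behind these steps is `exists_test_average`: a distribution commutes with weighted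
averages of translates of a test function. It follows by the Hahn–Banach theorem from the fact that
on a fixed compact set a distribution depends continuously on finitely many derivatives.
-/

noncomputable section

namespace PeriodicBehaviour

open MeasureTheory Topology Filter TopologicalSpace
open scoped BoundedContinuousFunction

/-! ### Jets of test functions -/

section Jets

variable {E : Type} [NormedAddCommGroup E] [NormedSpace ℝ E]

lemma Test.hasCompactSupport_iteratedFDeriv (f : Test E) (i : ℕ) :
    HasCompactSupport (iteratedFDeriv ℝ i f) :=
  f.hasCompactSupport.iteratedFDeriv i

lemma Test.continuous_iteratedFDeriv (f : Test E) (i : ℕ) :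
    Continuous (iteratedFDeriv ℝ i f) :=
  f.contDiff.continuous_iteratedFDeriv (mod_cast le_top)

/-- The normed space of families of bounded continuous functions in which the derivatives of
order at most `N` of a test function live, with the maximum of the sup norms. -/
def JetSpace (E : Type) [NormedAddCommGroup E] [NormedSpace ℝ E] (N : ℕ) : Type :=
  (i : Fin (N + 1)) → E →ᵇ (E [×(i : ℕ)]→L[ℝ] ℝ)

instance (N : ℕ) : NormedAddCommGroup (JetSpace E N) :=
  inferInstanceAs (NormedAddCommGroup ((i : Fin (N + 1)) → E →ᵇ (E [×(i : ℕ)]→L[ℝ] ℝ)))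

instance (N : ℕ) : NormedSpace ℝ (JetSpace E N) :=
  inferInstanceAs (NormedSpace ℝ ((i : Fin (N + 1)) → E →ᵇ (E [×(i : ℕ)]→L[ℝ] ℝ)))

instance (N : ℕ) : CompleteSpace (JetSpace E N) :=
  inferInstanceAs (CompleteSpace ((i : Fin (N + 1)) → E →ᵇ (E [×(i : ℕ)]→L[ℝ] ℝ)))

/-- Evaluation of the component of order `i` of a jet at a point. -/
def JetSpace.evalCLM {N : ℕ} (i : Fin (N + 1)) (x : E) :
    JetSpace E N →L[ℝ] (E [×(i : ℕ)]→L[ℝ] ℝ) :=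
  (BoundedContinuousFunction.evalCLM ℝ x).comp
    (ContinuousLinearMap.proj (R := ℝ) (φ := fun i : Fin (N + 1) => E →ᵇ (E [×(i : ℕ)]→L[ℝ] ℝ)) i)

lemma JetSpace.ext {N : ℕ} {u v : JetSpace E N} (h : ∀ i x, evalCLM i x u = evalCLM i x v) :
    u = v :=
  funext fun i => BoundedContinuousFunction.ext (h i)

lemma JetSpace.norm_le_iff {N : ℕ} {u : JetSpace E N} {C : ℝ} (hC : 0 ≤ C) :
    ‖u‖ ≤ C ↔ ∀ i x, ‖evalCLM i x u‖ ≤ C :=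
  (pi_norm_le_iff_of_nonneg hC).trans
    (forall_congr' fun _ => BoundedContinuousFunction.norm_le hC)

lemma JetSpace.norm_evalCLM_le {N : ℕ} (u : JetSpace E N) (i : Fin (N + 1)) (x : E) :
    ‖evalCLM i x u‖ ≤ ‖u‖ :=
  (norm_le_iff (norm_nonneg _)).1 le_rfl i x

/-- The derivatives of order at most `N` of a test function. -/
def jet (N : ℕ) : Test E →ₗ[ℝ] JetSpace E N where
  toFun f i := BoundedContinuousFunction.ofNormedAddCommGroup (iteratedFDeriv ℝ i f)
    (f.continuous_iteratedFDeriv i)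
    ((f.hasCompactSupport_iteratedFDeriv i).exists_bound_of_continuous
      (f.continuous_iteratedFDeriv i)).choose
    ((f.hasCompactSupport_iteratedFDeriv i).exists_bound_of_continuous
      (f.continuous_iteratedFDeriv i)).choose_spec
  map_add' f g := JetSpace.ext fun _ _ =>
    iteratedFDeriv_add_apply (f.contDiff.contDiffAt.of_le (mod_cast le_top))
      (g.contDiff.contDiffAt.of_le (mod_cast le_top))
  map_smul' _ f := JetSpace.ext fun _ _ =>
    iteratedFDeriv_const_smul_apply (f.contDiff.contDiffAt.of_le (mod_cast le_top))

lemma jet_injective (N : ℕ) : Function.Injective (jet (E := E) N) := by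
  intro f g h
  ext x
  have h0 : JetSpace.evalCLM 0 x (jet N f) = JetSpace.evalCLM 0 x (jet N g) := by rw [h]
  exact congrArg (fun A : E [×0]→L[ℝ] ℝ => A (fun _ => 0)) h0

/-- A real-linear functional on a real vector space that is dominated by the norm of an injective
linear map into a normed space factors through a continuous functional. -/
lemma exists_clm_of_norm_le {V X : Type*} [AddCommGroup V] [Module ℝ V] [NormedAddCommGroup X]
    [NormedSpace ℝ X] (J : V →ₗ[ℝ] X) (hJ : Function.Injective J) (L : V →ₗ[ℝ] ℝ) (C : ℝ)
    (h : ∀ f, |L f| ≤ C * ‖J f‖) : ∃ l : X →L[ℝ] ℝ, ∀ f, L f = l (J f) := by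
  let e := LinearEquiv.ofInjective J hJ
  have he : ∀ p : LinearMap.range J, (p : X) = J (e.symm p) := fun p => by
    conv_lhs => rw [← e.apply_symm_apply p]
    rfl
  let f : LinearMap.range J →L[ℝ] ℝ :=
    (L ∘ₗ e.symm.toLinearMap).mkContinuous C fun p => by
      simpa [he p] using h (e.symm p)
  obtain ⟨g, hg, -⟩ := exists_extension_norm_eq (LinearMap.range J) f
  refine ⟨g, fun v => ?_⟩
  have := hg (e v)
  have h2 : ((e v : LinearMap.range J) : X) = J v := rfl
  rw [h2] at this
  rw [this]
  simp [f]

/-- On the test functions supported in a fixed compact set, a distribution is a continuous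
functional of finitely many derivatives. The continuity of the distribution gives a bound by
finitely many seminorms, and the Hahn–Banach theorem extends the real and the imaginary part to the
Banach space of jets, where integrals can be interchanged with the functional. -/
lemma exists_jet_representation (T : Distr E) (K : Compacts E) :
    ∃ (N : ℕ) (l : JetSpace E N →L[ℝ] ℂ), ∀ f : Test E, tsupport f ⊆ K → T f = l (jet N f) := by
  let TK : 𝓓_{K}(E, ℝ) →ₗ[ℝ] ℂ := T.toLinearMap ∘ₗ
    (TestFunction.ofSupportedInCLM ℝ (K := K) (Ω := (⊤ : Opens E)) (by simp)).toLinearMap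
  have hTK : Continuous TK := T.continuous.comp
    (TestFunction.ofSupportedInCLM ℝ (K := K) (Ω := (⊤ : Opens E)) (by simp)).continuous
  obtain ⟨s, C, -, hC⟩ := Seminorm.bound_of_continuous
    (ContDiffMapSupportedIn.withSeminorms ℝ E ℝ ⊤ K) ((normSeminorm ℝ ℂ).comp TK)
    (continuous_norm.comp hTK)
  set N := s.sup id with hN
  let J : 𝓓_{K}(E, ℝ) →ₗ[ℝ] JetSpace E N := jet N ∘ₗ
    (TestFunction.ofSupportedInCLM ℝ (K := K) (Ω := (⊤ : Opens E)) (by simp)).toLinearMap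
  have hJ : Function.Injective J := (jet_injective N).comp fun f g h => by
    ext x
    exact congrArg (fun k : Test E => k x) h
  have hb : ∀ f, ‖TK f‖ ≤ C * ‖J f‖ := fun f => by
    refine (hC f).trans ?_
    change (C : ℝ) * _ ≤ _
    refine mul_le_mul_of_nonneg_left ?_ C.2
    refine Seminorm.finset_sup_apply_le (norm_nonneg _) fun i hi => ?_
    have hi' : i < N + 1 := Nat.lt_succ_of_le (Finset.le_sup (f := id) hi)
    refine (ContDiffMapSupportedIn.seminorm_top_le_iff ℝ (norm_nonneg _) i f).2 fun x _ => ?_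
    exact (J f).norm_evalCLM_le ⟨i, hi'⟩ x
  obtain ⟨l₁, h₁⟩ := exists_clm_of_norm_le J hJ (Complex.reLm ∘ₗ TK) C
    fun f => (Complex.abs_re_le_norm (TK f)).trans (hb f)
  obtain ⟨l₂, h₂⟩ := exists_clm_of_norm_le J hJ (Complex.imLm ∘ₗ TK) C
    fun f => (Complex.abs_im_le_norm (TK f)).trans (hb f)
  refine ⟨N, Complex.equivRealProdCLM.symm.toContinuousLinearMap.comp (l₁.prod l₂), fun f hf => ?_⟩
  let fK : 𝓓_{K}(E, ℝ) := .of_support_subset f.contDiff (subset_closure.trans hf)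
  have e₁ := h₁ fK
  have e₂ := h₂ fK
  have e₃ : J fK = jet N f := rfl
  have e₄ : TK fK = T f := rfl
  rw [e₃] at e₁ e₂
  apply Complex.ext
  · simpa [e₄] using e₁
  · simpa [e₄] using e₂

end Jets

/-! ### Averages of translates -/

section Average

variable {E : Type} [NormedAddCommGroup E] {Y : Type*} [MeasurableSpace Y] {μ : Measure Y}
  {c : Y → ℝ} {γ : Y → E} {F : Type} [NormedAddCommGroup F] [NormedSpace ℝ F]

lemma integrable_smul_comp_add (hc : Integrable c μ) (hγ : AEStronglyMeasurable γ μ) {g : E → F}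
    (hg : Continuous g) (hg' : HasCompactSupport g) (x : E) :
    Integrable (fun y => c y • g (x + γ y)) μ := by
  obtain ⟨C, hC⟩ := hg'.exists_bound_of_continuous hg
  refine hc.smul_bdd C ?_ (Eventually.of_forall fun y => hC _)
  exact (hg.comp (continuous_const.add continuous_id)).comp_aestronglyMeasurable hγ

variable [NormedSpace ℝ E]

lemma hasFDerivAt_average (hc : Integrable c μ) (hγ : AEStronglyMeasurable γ μ) {g : E → F}
    (hg : ContDiff ℝ (⊤ : ℕ∞) g) (hg' : HasCompactSupport g) (x : E) :
    HasFDerivAt (fun x => ∫ y, c y • g (x + γ y) ∂μ) (∫ y, c y • fderiv ℝ g (x + γ y) ∂μ) x := by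
  have hd : Continuous (fderiv ℝ g) := hg.continuous_fderiv (by simp)
  obtain ⟨C, hC⟩ := (hg'.fderiv ℝ).exists_bound_of_continuous hd
  refine hasFDerivAt_integral_of_dominated_of_fderiv_le (bound := fun y => ‖c y‖ * C)
    (F' := fun x y => c y • fderiv ℝ g (x + γ y)) univ_mem
    (.of_forall fun x => (integrable_smul_comp_add hc hγ hg.continuous hg' x).1)
    (integrable_smul_comp_add hc hγ hg.continuous hg' x)
    (integrable_smul_comp_add hc hγ hd (hg'.fderiv ℝ) x).1
    (.of_forall fun y x _ => ?_) (hc.norm.mul_const C) (.of_forall fun y x _ => ?_)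
  · rw [norm_smul]
    exact mul_le_mul_of_nonneg_left (hC _) (norm_nonneg _)
  · have h := (hg.differentiable (by simp) (x + γ y)).hasFDerivAt
    exact ((hasFDerivAt_comp_add_right (γ y)).2 h).const_smul (c y)

lemma contDiff_average (hc : Integrable c μ) (hγ : AEStronglyMeasurable γ μ) {g : E → F}
    (hg : ContDiff ℝ (⊤ : ℕ∞) g) (hg' : HasCompactSupport g) :
    ContDiff ℝ (⊤ : ℕ∞) (fun x => ∫ y, c y • g (x + γ y) ∂μ) := by
  rw [contDiff_infty]
  intro n
  induction n generalizing F with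
  | zero =>
    exact contDiff_zero.2 (continuous_iff_continuousAt.2 fun x =>
      (hasFDerivAt_average hc hγ hg hg' x).continuousAt)
  | succ n ih =>
    rw [Nat.cast_add, Nat.cast_one, contDiff_succ_iff_fderiv]
    refine ⟨fun x => (hasFDerivAt_average hc hγ hg hg' x).differentiableAt, by simp, ?_⟩
    rw [funext fun x => (hasFDerivAt_average hc hγ hg hg' x).fderiv]
    exact ih (hg.fderiv_right (by simp)) (hg'.fderiv ℝ)

lemma integral_comp_linearIsometryEquiv {G : Type*} [NormedAddCommGroup G] [NormedSpace ℝ G]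
    (e : F ≃ₗᵢ[ℝ] G) (f : Y → F) : ∫ y, e (f y) ∂μ = e (∫ y, f y ∂μ) :=
  e.toContinuousLinearEquiv.integral_comp_comm f

lemma iteratedFDeriv_average (hc : Integrable c μ) (hγ : AEStronglyMeasurable γ μ)
    {g : E → F} (hg : ContDiff ℝ (⊤ : ℕ∞) g) (hg' : HasCompactSupport g) (i : ℕ) (x : E) :
    iteratedFDeriv ℝ i (fun x => ∫ y, c y • g (x + γ y) ∂μ) x =
      ∫ y, c y • iteratedFDeriv ℝ i g (x + γ y) ∂μ := by
  induction i generalizing F x with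
  | zero =>
    simp only [iteratedFDeriv_zero_eq_comp, Function.comp_apply]
    rw [← integral_comp_linearIsometryEquiv]
    simp
  | succ i ih =>
    simp only [iteratedFDeriv_succ_eq_comp_right, Function.comp_apply]
    rw [funext fun x => (hasFDerivAt_average hc hγ hg hg' x).fderiv,
      ih (hg.fderiv_right (by simp)) (hg'.fderiv ℝ)]
    refine (integral_comp_linearIsometryEquiv (Y := Y) (μ := μ) (F := E [×i]→L[ℝ] E →L[ℝ] F)
      (G := E [×(i + 1)]→L[ℝ] F)
      (by exact (continuousMultilinearCurryRightEquiv' ℝ i E F).symm) _).symm.trans ?_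
    simp only [map_smul]

end Average

section Translates

variable {E : Type} [NormedAddCommGroup E]

lemma tsupport_subset_closedBall_add {f g : E → ℝ} {r R : ℝ} {y : E}
    (hf : tsupport f ⊆ Metric.closedBall 0 r) (hy : ‖y‖ ≤ R) (hg : ∀ x, f (x + y) = 0 → g x = 0) :
    tsupport g ⊆ Metric.closedBall 0 (r + R) := by
  refine closure_minimal (fun x hx => ?_) Metric.isClosed_closedBall
  have h1 : x + y ∈ Metric.closedBall (0 : E) r :=
    hf (subset_closure fun h => hx (hg x h))
  rw [mem_closedBall_zero_iff] at h1 ⊢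
  calc ‖x‖ = ‖(x + y) - y‖ := by simp
    _ ≤ ‖x + y‖ + ‖y‖ := norm_sub_le _ _
    _ ≤ r + R := add_le_add h1 hy

variable [NormedSpace ℝ E]

lemma evalCLM_jet_translateTest {N : ℕ} (y : E) (f : Test E) (i : Fin (N + 1)) (x : E) :
    JetSpace.evalCLM i x (jet N (translateTest y f)) = iteratedFDeriv ℝ i f (x + y) :=
  iteratedFDeriv_comp_add_right _ _ _

lemma norm_jet_translateTest_le (N : ℕ) (y : E) (f : Test E) :
    ‖jet N (translateTest y f)‖ ≤ ‖jet N f‖ := by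
  refine (JetSpace.norm_le_iff (norm_nonneg _)).2 fun i x => ?_
  rw [evalCLM_jet_translateTest]
  exact (jet N f).norm_evalCLM_le i (x + y)

lemma continuous_jet_translateTest (N : ℕ) (f : Test E) :
    Continuous fun y => jet N (translateTest y f) := by
  refine continuous_pi fun i => ?_
  have hu : UniformContinuous (iteratedFDeriv ℝ i f) :=
    (f.hasCompactSupport_iteratedFDeriv i).uniformContinuous_of_continuous
      (f.continuous_iteratedFDeriv i)
  refine Metric.continuous_iff.2 fun y ε hε => ?_
  obtain ⟨δ, hδ, h⟩ := Metric.uniformContinuous_iff.1 hu (ε / 2) (half_pos hε)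
  refine ⟨δ, hδ, fun z hz => lt_of_le_of_lt ?_ (half_lt_self hε)⟩
  refine (BoundedContinuousFunction.dist_le (half_pos hε).le).2 fun x => ?_
  have e := evalCLM_jet_translateTest (N := N) z f i x
  have e' := evalCLM_jet_translateTest (N := N) y f i x
  change dist (JetSpace.evalCLM i x (jet N (translateTest z f)))
    (JetSpace.evalCLM i x (jet N (translateTest y f))) ≤ _
  rw [e, e']
  exact (h (by simpa using hz)).le

lemma Test.exists_tsupport_subset_closedBall (f : Test E) :
    ∃ r, tsupport f ⊆ Metric.closedBall 0 r :=
  (f.hasCompactSupport.isCompact.isBounded).subset_closedBall 0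

lemma lineDerivOp_test_apply (f : Test E) (b x : E) : (∂_{b} f) x = fderiv ℝ f x b := by
  change TestFunction.lineDerivCLM ℝ b f x = _
  rw [TestFunction.lineDerivCLM_apply, if_pos (by simp),
    ((f.contDiff.differentiable (by simp)) x).lineDeriv_eq_fderiv]

lemma translateTest_zero (f : Test E) : translateTest 0 f = f := by
  ext x
  simp

lemma translateTest_add (y z : E) (f : Test E) :
    translateTest y (translateTest z f) = translateTest (y + z) f := by
  ext x
  simp [add_assoc]

lemma translateTest_lineDerivOp (y b : E) (f : Test E) :
    translateTest y (∂_{b} f : Test E) = ∂_{b} (translateTest y f) := by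
  ext x
  rw [translateTest_apply, lineDerivOp_test_apply, lineDerivOp_test_apply]
  exact congrArg (fun L : E →L[ℝ] ℝ => L b) (fderiv_comp_add_right (f := f) y).symm

variable [FiniteDimensional ℝ E] {Y : Type*} [MeasurableSpace Y] {μ : Measure Y} {c : Y → ℝ}
  {γ : Y → E}

/-- A distribution commutes with weighted averages of translates of a test function: such an
average is again a test function, and the value of the distribution at it is the average of the
values at the translates. -/
lemma exists_test_average (hc : Integrable c μ) (hγ : AEStronglyMeasurable γ μ) {R : ℝ}
    (hR : ∀ y, c y ≠ 0 → ‖γ y‖ ≤ R) (f : Test E) :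
    ∃ g : Test E, (∀ x, g x = ∫ y, c y * f (x + γ y) ∂μ) ∧
      ∀ T : Distr E, T g = ∫ y, c y • T (translateTest (γ y) f) ∂μ := by
  obtain ⟨r, hr⟩ := f.exists_tsupport_subset_closedBall
  let K : Compacts E := ⟨Metric.closedBall 0 (r + R), isCompact_closedBall _ _⟩
  have hsupp : tsupport (fun x => ∫ y, c y • f (x + γ y) ∂μ) ⊆ K := by
    refine closure_minimal (fun x hx => ?_) Metric.isClosed_closedBall
    obtain ⟨y, hy⟩ : ∃ y, c y • f (x + γ y) ≠ 0 := by
      by_contra! h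
      exact hx ((integral_congr_ae (.of_forall h)).trans (integral_zero _ _))
    refine tsupport_subset_closedBall_add (g := fun x => f (x + γ y)) hr
      (hR y (left_ne_zero_of_smul hy)) (fun _ h => h) (subset_closure (right_ne_zero_of_smul hy))
  let g : Test E :=
    { toFun := fun x => ∫ y, c y • f (x + γ y) ∂μ
      contDiff' := contDiff_average hc hγ f.contDiff f.hasCompactSupport
      hasCompactSupport' := K.isCompact.of_isClosed_subset (isClosed_tsupport _) hsupp
      tsupport_subset' := by simp }
  refine ⟨g, fun x => rfl, fun T => ?_⟩
  obtain ⟨N, l, hl⟩ := exists_jet_representation T K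
  have hint : Integrable (fun y => c y • jet N (translateTest (γ y) f)) μ :=
    hc.smul_bdd ‖jet N f‖ ((continuous_jet_translateTest N f).comp_aestronglyMeasurable hγ)
      (Eventually.of_forall fun y => norm_jet_translateTest_le N _ f)
  have hjet : jet N g = ∫ y, c y • jet N (translateTest (γ y) f) ∂μ := by
    refine JetSpace.ext fun i x => ?_
    rw [← (JetSpace.evalCLM i x).integral_comp_comm hint]
    refine (iteratedFDeriv_average hc hγ f.contDiff f.hasCompactSupport i x).trans ?_
    refine integral_congr_ae (Eventually.of_forall fun y => ?_)
    simp only [map_smul, evalCLM_jet_translateTest]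
  rw [hl g hsupp, hjet, ← l.integral_comp_comm hint]
  refine integral_congr_ae (Eventually.of_forall fun y => ?_)
  by_cases hy : c y = 0
  · simp [hy]
  · change l (c y • jet N (translateTest (γ y) f)) = _
    rw [map_smul, ← hl (translateTest (γ y) f)
      (tsupport_subset_closedBall_add hr (hR y hy) fun _ h => h)]

lemma continuous_distr_translateTest (T : Distr E) (f : Test E) :
    Continuous fun y => T (translateTest y f) := by
  obtain ⟨r, hr⟩ := f.exists_tsupport_subset_closedBall
  refine continuous_iff_continuousAt.2 fun y => ?_
  let K : Compacts E := ⟨Metric.closedBall 0 (r + (‖y‖ + 1)), isCompact_closedBall _ _⟩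
  obtain ⟨N, l, hl⟩ := exists_jet_representation T K
  refine ((l.continuous.comp (continuous_jet_translateTest N f)).continuousAt
    (x := y)).congr ?_
  filter_upwards [Metric.ball_mem_nhds y one_pos] with z hz
  refine (hl _ (tsupport_subset_closedBall_add hr ?_ fun _ h => h)).symm
  have := norm_sub_norm_le z y
  rw [Metric.mem_ball, dist_eq_norm] at hz
  linarith

/-- The fundamental theorem of calculus for the translates of a test function, paired with a
distribution. -/
lemma distr_translateTest_smul_sub (T : Distr E) (f : Test E) (b : E) (s : ℝ) :
    T (translateTest (s • b) f) - T f =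
      ∫ r in (0 : ℝ)..s, T (translateTest (r • b) (∂_{b} f : Test E)) := by
  -- By the fundamental theorem of calculus, `f(· + s b) - f` is the average of the translates of
  -- `∂_b f` by `s r b` over `r ∈ [0, 1]`, with weight `s`.
  obtain ⟨g, hg, hT⟩ := exists_test_average (μ := volume.restrict (Set.Ioc (0 : ℝ) 1))
    (c := Set.indicator (Set.Icc (0 : ℝ) 1) fun _ => s) (γ := fun r => (s * r) • b) (R := |s| * ‖b‖)
    ((integrable_const s).indicator measurableSet_Icc)
    (by fun_prop) (fun r hr => by
      have hr : r ∈ Set.Icc (0 : ℝ) 1 := Set.mem_of_indicator_ne_zero hr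
      rw [norm_smul, Real.norm_eq_abs, abs_mul, abs_of_nonneg hr.1]
      refine mul_le_mul_of_nonneg_right ?_ (norm_nonneg _)
      exact mul_le_of_le_one_right (abs_nonneg _) hr.2) (∂_{b} f : Test E)
  have hind : ∀ r ∈ Set.Ioc (0 : ℝ) 1, Set.indicator (Set.Icc (0 : ℝ) 1) (fun _ => s) r = s :=
    fun r hr => Set.indicator_of_mem (Set.Ioc_subset_Icc_self hr) _
  have hgf : g = translateTest (s • b) f - f := by
    ext x
    rw [hg]
    have h1 : ∀ r ∈ Set.uIcc (0 : ℝ) s,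
        HasDerivAt (fun r : ℝ => f (x + r • b)) ((∂_{b} f : Test E) (x + r • b)) r := fun r _ => by
      rw [lineDerivOp_test_apply]
      have h2 := ((f.contDiff.differentiable (by simp)) (x + r • b)).hasFDerivAt
      have h3 : HasDerivAt (fun r : ℝ => x + r • b) b r := by
        simpa using ((hasDerivAt_id r).smul_const b).const_add x
      exact h2.comp_hasDerivAt r h3
    have h4 := intervalIntegral.integral_eq_sub_of_hasDerivAt h1
      (((∂_{b} f : Test E).continuous.comp (by fun_prop)).intervalIntegrable _ _)
    have h5 : (translateTest (s • b) f - f) x = f (x + s • b) - f (x + (0 : ℝ) • b) := by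
      simp
    rw [h5, ← h4]
    have h6 := intervalIntegral.smul_integral_comp_mul_left (a := (0 : ℝ)) (b := 1)
      (fun r : ℝ => (∂_{b} f : Test E) (x + r • b)) s
    rw [mul_zero, mul_one] at h6
    rw [← h6, ← intervalIntegral.integral_smul, intervalIntegral.integral_of_le zero_le_one]
    exact setIntegral_congr_fun measurableSet_Ioc fun r hr => by
      simp only [hind r hr, smul_eq_mul]
  have h7 := hT T
  rw [hgf, map_sub] at h7
  rw [h7]
  have h6 := intervalIntegral.smul_integral_comp_mul_left (a := (0 : ℝ)) (b := 1)
      (fun r : ℝ => T (translateTest (r • b) (∂_{b} f : Test E))) s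
  rw [mul_zero, mul_one] at h6
  rw [← h6, ← intervalIntegral.integral_smul, intervalIntegral.integral_of_le zero_le_one]
  exact setIntegral_congr_fun measurableSet_Ioc fun r hr => by
    simp only [hind r hr]

lemma hasDerivAt_distr_translateTest (T : Distr E) (f : Test E) (y b : E) (s : ℝ) :
    HasDerivAt (fun r : ℝ => T (translateTest (y + r • b) f))
      (T (translateTest (y + s • b) (∂_{b} f : Test E))) s := by
  have hc : Continuous fun r : ℝ =>
      T (translateTest (r • b) (∂_{b} (translateTest y f) : Test E)) :=
    (continuous_distr_translateTest T _).comp (by fun_prop)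
  have h1 := intervalIntegral.integral_hasDerivAt_right (hc.intervalIntegrable 0 s)
    (hc.stronglyMeasurableAtFilter _ _) hc.continuousAt
  have h2 := h1.add_const (T (translateTest y f))
  rw [← translateTest_lineDerivOp, translateTest_add, add_comm] at h2
  refine h2.congr_of_eventuallyEq (Eventually.of_forall fun r => ?_)
  simp only
  rw [translateTest_lineDerivOp, ← distr_translateTest_smul_sub, translateTest_add, sub_add_cancel,
    add_comm]

end Translates

/-! ### Density of tensor products -/

/-- The normed bump function as a test function. -/
def bumpTest {E : Type} [NormedAddCommGroup E] [NormedSpace ℝ E] [FiniteDimensional ℝ E]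
    [HasContDiffBump E] [MeasurableSpace E] [BorelSpace E] (μ : Measure E)
    [IsLocallyFiniteMeasure μ] [μ.IsOpenPosMeasure] (f : ContDiffBump (0 : E)) : Test E where
  toFun := f.normed μ
  contDiff' := f.contDiff_normed
  hasCompactSupport' := f.hasCompactSupport_normed
  tsupport_subset' := by simp

lemma translateTest_tensorTest {d : ℕ} (p : SpaceTime d) (φ : Test ℝ) (ψ : Test (Space d)) :
    translateTest p (tensorTest φ ψ) = tensorTest (translateTest p.2 φ) (translateTest p.1 ψ) := by
  ext x
  rfl

instance {d : ℕ} : (volume : Measure (SpaceTime d)).IsAddHaarMeasure :=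
  inferInstanceAs ((volume : Measure (Space d)).prod (volume : Measure ℝ)).IsAddHaarMeasure

/-- The finite combinations of tensor products are dense: a distribution on `ℝ^{d+1}` that vanishes
on them is zero. Indeed, it vanishes on the convolution of a test function `f` with a narrow tensor
product `ρ` of bump functions, since this is an average of translates of `ρ`; but it is also an
average of translates of `f`, on which the distribution takes nearly the same value as on `f`. -/
lemma distr_eq_zero_of_tensorTest {d : ℕ} (T : Distr (SpaceTime d))
    (h : ∀ φ ψ, T (tensorTest φ ψ) = 0) : T = 0 := by
  ext f
  refine norm_le_zero_iff.1 (le_of_forall_pos_le_add fun ε hε => ?_)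
  rw [zero_add]
  have hH := continuous_distr_translateTest T f
  obtain ⟨δ, hδ, hε'⟩ := Metric.continuous_iff.1 hH 0 ε hε
  let b₁ : ContDiffBump (0 : Space d) := ⟨δ / 2, δ, half_pos hδ, half_lt_self hδ⟩
  let b₂ : ContDiffBump (0 : ℝ) := ⟨δ / 2, δ, half_pos hδ, half_lt_self hδ⟩
  let ψ := bumpTest volume b₁
  let φ := bumpTest volume b₂
  let ρ : Test (SpaceTime d) := tensorTest φ ψ
  have hρ : ∀ p, ρ p = b₁.normed volume p.1 * b₂.normed volume p.2 := fun p => rfl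
  have hρneg : ∀ p, ρ (-p) = ρ p := fun p => by
    rw [hρ, hρ, Prod.fst_neg, Prod.snd_neg, b₁.normed_neg, b₂.normed_neg]
  have hρ0 : ∀ p, 0 ≤ ρ p := fun p => mul_nonneg (b₁.nonneg_normed _) (b₂.nonneg_normed _)
  have hρint : Integrable ρ := ρ.continuous.integrable_of_hasCompactSupport ρ.hasCompactSupport
  have hρ1 : ∫ p, ρ p = 1 := by
    have := integral_prod_mul (μ := (volume : Measure (Space d))) (ν := (volume : Measure ℝ))
      (b₁.normed volume) (b₂.normed volume)
    rw [b₁.integral_normed, b₂.integral_normed, mul_one] at this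
    exact this
  have hρsupp : ∀ p, ρ p ≠ 0 → dist p 0 < δ := fun p hp => by
    rw [hρ] at hp
    have h1 : p.1 ∈ Function.support (b₁.normed volume) := left_ne_zero_of_mul hp
    have h2 : p.2 ∈ Function.support (b₂.normed volume) := right_ne_zero_of_mul hp
    rw [b₁.support_normed_eq] at h1
    rw [b₂.support_normed_eq] at h2
    exact max_lt h1 h2
  obtain ⟨g₁, hg₁, hT₁⟩ := exists_test_average (μ := (volume : Measure (SpaceTime d))) (γ := id)
    (R := δ) hρint aestronglyMeasurable_id (fun p hp => by
      simpa [dist_eq_norm] using (hρsupp p hp).le) f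
  obtain ⟨R, hR⟩ := Test.exists_tsupport_subset_closedBall f
  obtain ⟨g₂, hg₂, hT₂⟩ := exists_test_average (μ := (volume : Measure (SpaceTime d)))
    (c := f) (γ := fun p => -p) (R := R)
    (f.continuous.integrable_of_hasCompactSupport f.hasCompactSupport)
    (by fun_prop) (fun p hp => by
      simpa using hR (subset_closure hp)) ρ
  -- Both averages are the convolution of `f` with the even function `ρ`.
  have hg : g₁ = g₂ := by
    ext x
    rw [hg₁, hg₂, ← integral_add_left_eq_self (fun p => f p * ρ (x + -p)) x]
    refine integral_congr_ae (.of_forall fun p => ?_)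
    simp only [id]
    rw [show x + -(x + p) = -p by abel, hρneg, mul_comm]
  have hzero : ∫ p, ρ p • T (translateTest p f) = 0 := by
    have h1 := hT₁ T
    rw [hg, hT₂ T] at h1
    refine h1.symm.trans (integral_eq_zero_of_ae (.of_forall fun p => ?_))
    simp only [ρ, translateTest_tensorTest, h, smul_zero, Pi.zero_apply]
  have hint : Integrable fun p => ρ p • T (translateTest p f) :=
    (ρ.continuous.smul hH).integrable_of_hasCompactSupport ρ.hasCompactSupport.smul_right
  have key : T f = ∫ p, ρ p • (T f - T (translateTest p f)) := by
    simp only [smul_sub]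
    rw [integral_sub (hρint.smul_const _) hint, hzero, sub_zero, integral_smul_const, hρ1, one_smul]
  rw [key]
  calc _ ≤ ∫ p, ρ p * ε := by
        refine norm_integral_le_of_norm_le (hρint.mul_const ε) (.of_forall fun p => ?_)
        rw [norm_smul, Real.norm_of_nonneg (hρ0 p)]
        by_cases hp : ρ p = 0
        · simp [hp]
        · refine mul_le_mul_of_nonneg_left ?_ (hρ0 p)
          have := hε' p (hρsupp p hp)
          rw [dist_comm, translateTest_zero, dist_eq_norm] at this
          exact this.le
    _ = ε := by rw [integral_mul_const, hρ1, one_mul]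

/-! ### Differential equations for functionals on the line -/

/-- The derivative of a linear functional on the test functions on the line. No continuity is
required of the functional. -/
def functionalDeriv : Module.End ℂ (Test ℝ →ₗ[ℝ] ℂ) where
  toFun u := -(u ∘ₗ (LineDeriv.lineDerivOpCLM ℝ (Test ℝ) (1 : ℝ)).toLinearMap)
  map_add' u v := by
    ext φ
    simp [add_comm]
  map_smul' c u := by
    ext φ
    simp

lemma functionalDeriv_apply (u : Test ℝ →ₗ[ℝ] ℂ) (φ : Test ℝ) :
    functionalDeriv u φ = -u (∂_{(1 : ℝ)} φ) := rfl

/-- A functional on the test functions on the line vanishes on the past if it is zero on the test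
functions supported in `t < 0`. -/
def VanishesOnPast (u : Test ℝ →ₗ[ℝ] ℂ) : Prop :=
  ∀ φ : Test ℝ, tsupport φ ⊆ Set.Iio 0 → u φ = 0

lemma VanishesOnPast.deriv {u : Test ℝ →ₗ[ℝ] ℂ} (hu : VanishesOnPast u) :
    VanishesOnPast (functionalDeriv u) := fun φ hφ => by
  rw [functionalDeriv_apply, hu, neg_zero]
  refine (closure_mono fun t ht => ?_).trans ((tsupport_fderiv_subset ℝ (f := φ)).trans hφ)
  intro h0
  refine ht ?_
  rw [lineDerivOp_test_apply, h0]
  rfl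

lemma lineDerivOp_one_test_apply (φ : Test ℝ) (t : ℝ) : (∂_{(1 : ℝ)} φ : Test ℝ) t = deriv φ t :=
  lineDerivOp_test_apply φ 1 t

/-- The equation `g' + c g = φ` has a smooth solution that vanishes for large times, namely
`g(t) = e^{-c t} ∫_R^t e^{c s} φ(s) ds`. -/
lemma exists_backward_solution (c : ℂ) (φ : Test ℝ) :
    ∃ (R : ℝ) (g : ℝ → ℂ), ContDiff ℝ (⊤ : ℕ∞) g ∧ (∀ t, R ≤ t → g t = 0) ∧
      ∀ t, HasDerivAt g (φ t - c * g t) t := by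
  obtain ⟨R, hR⟩ := φ.exists_tsupport_subset_closedBall
  let f : ℝ → ℂ := fun s => Complex.exp (c * s) * φ s
  have hofR : ContDiff ℝ (⊤ : ℕ∞) (fun s : ℝ => (s : ℂ)) := Complex.ofRealCLM.contDiff
  have hf : ContDiff ℝ (⊤ : ℕ∞) f :=
    ((Complex.contDiff_exp (𝕜 := ℝ)).comp (contDiff_const.mul hofR)).mul
      (hofR.comp φ.contDiff)
  let P : ℝ → ℂ := fun t => ∫ s in R..t, f s
  have hP : ∀ t, HasDerivAt P (f t) t := fun t =>
    intervalIntegral.integral_hasDerivAt_right (hf.continuous.intervalIntegrable _ _)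
      (hf.continuous.stronglyMeasurableAtFilter _ _) hf.continuous.continuousAt
  have hPs : ContDiff ℝ (⊤ : ℕ∞) P := by
    refine contDiff_infty_iff_deriv.2 ⟨fun t => (hP t).differentiableAt, ?_⟩
    rw [funext fun t => (hP t).deriv]
    exact hf
  refine ⟨R, fun t => Complex.exp (-c * t) * P t, ?_, fun t ht => ?_, fun t => ?_⟩
  · exact ((Complex.contDiff_exp (𝕜 := ℝ)).comp (contDiff_const.mul hofR)).mul hPs
  · have : P t = 0 := by
      refine intervalIntegral.integral_zero_ae (.of_forall fun s hs => ?_)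
      rw [Set.uIoc_of_le ht] at hs
      have : s ∉ tsupport φ := fun h => by
        have := hR h
        rw [mem_closedBall_zero_iff, Real.norm_eq_abs] at this
        linarith [le_abs_self s, hs.1]
      simp [f, image_eq_zero_of_notMem_tsupport this]
    simp [this]
  · have h1 : HasDerivAt (fun t : ℝ => Complex.exp (-c * t)) (Complex.exp (-c * t) * (-c)) t := by
      have := ((Complex.hasDerivAt_exp (-c * t)).comp (t : ℂ)
        ((hasDerivAt_id (t : ℂ)).const_mul (-c))).comp_ofReal
      simpa using this
    refine (h1.mul (hP t)).congr_deriv ?_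
    have h2 : Complex.exp (-c * t) * Complex.exp (c * t) = 1 := by
      rw [← Complex.exp_add]
      simp
    simp only [f]
    linear_combination (φ t : ℂ) * h2

/-- The composition of a smooth compactly supported function with a linear functional, as a test
function. -/
def compTest (L : ℂ →L[ℝ] ℝ) (h : ℝ → ℂ) (hs : ContDiff ℝ (⊤ : ℕ∞) h) (hc : HasCompactSupport h) :
    Test ℝ where
  toFun t := L (h t)
  contDiff' := L.contDiff.comp hs
  hasCompactSupport' := hc.comp_left (map_zero L)
  tsupport_subset' := by simp

/-- Uniqueness for `u' = c u`: every test function is, up to one supported in `t < 0`, of the form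
`η' + c η`, where `η` is a backward solution cut off in the past. -/
lemma VanishesOnPast.eq_zero_of_functionalDeriv_eq {u : Test ℝ →ₗ[ℝ] ℂ} (hu : VanishesOnPast u)
    {c : ℂ} (h : functionalDeriv u = c • u) : u = 0 := by
  have hd : ∀ φ, u (∂_{(1 : ℝ)} φ) = -c * u φ := fun φ => by
    have := congrArg (fun v : Test ℝ →ₗ[ℝ] ℂ => v φ) h
    simp only [functionalDeriv_apply, LinearMap.smul_apply, smul_eq_mul] at this
    linear_combination -this
  ext φ
  obtain ⟨R, g, hg, hgR, hg'⟩ := exists_backward_solution c φ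
  let η : ℝ → ℂ := fun t => (Real.smoothTransition (t + 2) : ℂ) * g t
  have hη : ContDiff ℝ (⊤ : ℕ∞) η :=
    (Complex.ofRealCLM.contDiff.comp
      (Real.smoothTransition.contDiff.comp (contDiff_id.add contDiff_const))).mul hg
  have hηc : HasCompactSupport η := by
    refine HasCompactSupport.intro (isCompact_Icc (a := (-2 : ℝ)) (b := R)) fun t ht => ?_
    rw [Set.mem_Icc, not_and_or, not_le, not_le] at ht
    rcases ht with ht | ht
    · simp [η, Real.smoothTransition.zero_of_nonpos (show t + 2 ≤ 0 by linarith)]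
    · simp [η, hgR t ht.le]
  have hη' : ∀ t, -1 < t → HasDerivAt η (φ t - c * η t) t := fun t ht => by
    have he : η =ᶠ[𝓝 t] g := by
      filter_upwards [Ioi_mem_nhds ht] with s hs
      have hs : -1 < s := hs
      simp [η, Real.smoothTransition.one_of_one_le (show 1 ≤ s + 2 by linarith)]
    rw [he.self_of_nhds]
    exact (hg' t).congr_of_eventuallyEq he
  -- Test functions are real-valued, so `η` and the remainder `φ - η' - c η`, which is supported in
  -- `t ≤ -1`, are split into their real and imaginary parts.
  let ηr := compTest Complex.reCLM η hη hηc
  let ηi := compTest Complex.imCLM η hη hηc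
  let r₁ : Test ℝ := φ - ∂_{(1 : ℝ)} ηr - c.re • ηr + c.im • ηi
  let r₂ : Test ℝ := -∂_{(1 : ℝ)} ηi - c.re • ηi - c.im • ηr
  have hpast : ∀ r : Test ℝ, (∀ t, -1 < t → r t = 0) → u r = 0 := fun r hr => by
    refine hu r ((closure_minimal (fun t ht => ?_) isClosed_Iic).trans
      (Set.Iic_subset_Iio.2 (show (-1 : ℝ) < 0 by norm_num)))
    exact not_lt.1 fun h => ht (hr t h)
  have hr₁ : u r₁ = 0 := hpast _ fun t ht => by
    have h1 : HasDerivAt ηr (φ t - c * η t).re t :=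
      (Complex.reCLM.hasFDerivAt.comp_hasDerivAt t (hη' t ht) :)
    have h2 : r₁ t = φ t - (∂_{(1 : ℝ)} ηr : Test ℝ) t - c.re * (η t).re + c.im * (η t).im := rfl
    rw [h2, lineDerivOp_one_test_apply, h1.deriv]
    simp
  have hr₂ : u r₂ = 0 := hpast _ fun t ht => by
    have h1 : HasDerivAt ηi (φ t - c * η t).im t :=
      (Complex.imCLM.hasFDerivAt.comp_hasDerivAt t (hη' t ht) :)
    have h2 : r₂ t = -(∂_{(1 : ℝ)} ηi : Test ℝ) t - c.re * (η t).im - c.im * (η t).re := rfl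
    rw [h2, lineDerivOp_one_test_apply, h1.deriv]
    simp
  simp only [r₁, r₂, map_add, map_sub, map_neg, map_smul, hd, Complex.real_smul] at hr₁ hr₂
  rw [LinearMap.zero_apply]
  linear_combination hr₁ + Complex.I * hr₂ +
    (u ηr + Complex.I * u ηi) * Complex.re_add_im c - c.im * u ηi * Complex.I_sq

/-- An ordinary differential equation with constant coefficients determines a functional on test
functions by its values on those supported in `t < 0`. -/
lemma VanishesOnPast.eq_zero_of_aeval_eq_zero {u : Test ℝ →ₗ[ℝ] ℂ} (hu : VanishesOnPast u)
    {q : Polynomial ℂ} (hq : q ≠ 0)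
    (h : Polynomial.aeval functionalDeriv q u = 0) : u = 0 := by
  -- The linear factors of `q` are removed one at a time.
  have key : ∀ (s : Multiset ℂ) (v : Test ℝ →ₗ[ℝ] ℂ), VanishesOnPast v →
      Polynomial.aeval functionalDeriv
        (s.map fun r => Polynomial.X - Polynomial.C r).prod v = 0 → v = 0 := by
    intro s
    induction s using Multiset.induction_on with
    | empty => simp
    | cons r s ih =>
      intro v hv h
      rw [Multiset.map_cons, Multiset.prod_cons, mul_comm, map_mul, Module.End.mul_apply] at h
      have h1 := ih _ (fun φ hφ => ?_) h
      · simp only [map_sub, Polynomial.aeval_X, Polynomial.aeval_C, LinearMap.sub_apply,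
          Module.algebraMap_end_apply, sub_eq_zero] at h1
        exact hv.eq_zero_of_functionalDeriv_eq h1
      · simp [hv φ hφ, hv.deriv φ hφ]
  rw [(IsAlgClosed.splits q).eq_prod_roots, map_mul, Polynomial.aeval_C, Module.End.mul_apply,
    Module.algebraMap_end_apply] at h
  exact key _ u hu ((smul_eq_zero.1 h).resolve_left (by simpa using hq))

/-! ### Polynomial matrices -/

section PolynomialMatrices

open Polynomial

variable {m n : ℕ}

/-- If `N(t)` has full column rank for some `t`, then `N` has a left inverse up to a nonzero scalar
polynomial: for a left inverse `B₀` of `N(t)`, the square matrix `B₀ N` has determinant `1` at `t`,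
and its adjugate provides the left inverse. -/
lemma exists_mul_eq_smul_one {N : Matrix (Fin m) (Fin n) ℂ[X]} {t : ℂ}
    (h : (N.map (eval t)).rank = n) :
    ∃ (B : Matrix (Fin n) (Fin m) ℂ[X]) (q : ℂ[X]), q ≠ 0 ∧ B * N = q • 1 := by
  have hinj : LinearMap.ker (N.map (eval t)).mulVecLin = ⊥ := by
    have := LinearMap.finrank_range_add_finrank_ker (N.map (eval t)).mulVecLin
    rw [← Matrix.rank, h, Module.finrank_fin_fun] at this
    exact Submodule.finrank_eq_zero.1 (by omega)
  obtain ⟨g, hg⟩ := LinearMap.exists_leftInverse_of_injective _ hinj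
  let B₀ := LinearMap.toMatrix' g
  have hB₀ : B₀ * N.map (eval t) = 1 := by
    have := congrArg LinearMap.toMatrix' hg
    rwa [LinearMap.toMatrix'_comp, LinearMap.toMatrix'_id, ← Matrix.toLin'_apply',
      LinearMap.toMatrix'_toLin'] at this
  let Q : Matrix (Fin n) (Fin n) ℂ[X] := B₀.map C * N
  refine ⟨Q.adjugate * B₀.map C, Q.det, fun h0 => ?_, ?_⟩
  · have h1 : (evalRingHom t) Q.det = 1 := by
      rw [RingHom.map_det, RingHom.mapMatrix_apply, Matrix.map_mul, Matrix.map_map]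
      have : B₀.map (⇑(evalRingHom t) ∘ ⇑C) = B₀ := by
        ext i j
        simp
      rw [this]
      exact (congrArg Matrix.det hB₀).trans Matrix.det_one
    rw [h0, map_zero] at h1
    exact zero_ne_one h1
  · rw [Matrix.mul_assoc]
    exact Q.adjugate_mul

/-- If `N(t)` has full column rank for no `t`, then the columns of `N` are linearly dependent.
Otherwise `N` would have a left inverse over the field of fractions; away from the zeros of a common
denominator this can be evaluated. -/
lemma exists_mulVec_eq_zero_of_rank_ne {N : Matrix (Fin m) (Fin n) ℂ[X]}
    (h : ∀ t, (N.map (eval t)).rank ≠ n) : ∃ q : Fin n → ℂ[X], q ≠ 0 ∧ N.mulVec q = 0 := by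
  by_contra! hN
  let K := FractionRing ℂ[X]
  let NK : Matrix (Fin m) (Fin n) K := N.map (algebraMap ℂ[X] K)
  have hK : Function.Injective (algebraMap ℂ[X] K) := IsFractionRing.injective _ _
  have hinj : LinearMap.ker NK.mulVecLin = ⊥ := by
    refine LinearMap.ker_eq_bot'.2 fun x hx => ?_
    obtain ⟨b, hb⟩ := IsLocalization.exist_integer_multiples_of_finite (nonZeroDivisors ℂ[X]) x
    choose y hy using hb
    have hy0 : N.mulVec y = 0 := by
      refine hK.comp_left ?_
      have h1 : algebraMap ℂ[X] K ∘ N.mulVec y = NK.mulVec (algebraMap ℂ[X] K ∘ y) :=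
        funext fun i => (algebraMap ℂ[X] K).map_mulVec N y i
      have h2 : algebraMap ℂ[X] K ∘ y = (b : ℂ[X]) • x := funext hy
      beta_reduce
      rw [h1, h2, Matrix.mulVec_smul]
      rw [Matrix.mulVecLin_apply] at hx
      rw [hx]
      ext
      simp
    have hy1 : y = 0 := by
      by_contra h0
      exact hN y h0 hy0
    ext i
    have := hy i
    rw [hy1, Pi.zero_apply, map_zero, eq_comm, Algebra.smul_def, mul_eq_zero] at this
    exact this.resolve_left fun h0 =>
      nonZeroDivisors.ne_zero b.2 (hK (h0.trans (map_zero _).symm))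
  obtain ⟨g, hg⟩ := LinearMap.exists_leftInverse_of_injective _ hinj
  let B₀ := LinearMap.toMatrix' g
  have hB₀ : B₀ * NK = 1 := by
    have := congrArg LinearMap.toMatrix' hg
    rwa [LinearMap.toMatrix'_comp, LinearMap.toMatrix'_id, ← Matrix.toLin'_apply',
      LinearMap.toMatrix'_toLin'] at this
  obtain ⟨b, hb⟩ := IsLocalization.exist_integer_multiples_of_finite (nonZeroDivisors ℂ[X])
    (fun p : Fin n × Fin m => B₀ p.1 p.2)
  choose y hy using hb
  let B : Matrix (Fin n) (Fin m) ℂ[X] := Matrix.of fun i j => y (i, j)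
  have hBmap : B.map (algebraMap ℂ[X] K) = algebraMap ℂ[X] K b • B₀ := by
    ext i j
    exact (hy (i, j)).trans (Algebra.smul_def _ _)
  have hBN : B * N = (b : ℂ[X]) • 1 := by
    refine Matrix.map_injective hK ?_
    beta_reduce
    rw [Matrix.map_mul, hBmap, Matrix.smul_mul, hB₀]
    ext i j
    by_cases hij : i = j <;> simp [hij]
  obtain ⟨t, ht⟩ : ∃ t, eval t (b : ℂ[X]) ≠ 0 := by
    by_contra! h0
    exact nonZeroDivisors.ne_zero b.2 (Polynomial.funext fun t => by simp [h0 t])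
  refine h t (le_antisymm (Matrix.rank_le_width _) ?_)
  have hu : IsUnit (eval t (b : ℂ[X]) • (1 : Matrix (Fin n) (Fin n) ℂ)) :=
    (Matrix.isUnit_iff_isUnit_det _).2 (by simp [ht])
  have h1 := Matrix.rank_of_isUnit _ hu
  rw [Fintype.card_fin] at h1
  have h2 : B.map (eval t) * N.map (eval t) = eval t (b : ℂ[X]) • 1 := by
    have := congrArg (fun A : Matrix (Fin n) (Fin n) ℂ[X] => A.map (evalRingHom t)) hBN
    simp only [Matrix.map_mul] at this
    refine this.trans ?_
    ext i j
    by_cases hij : i = j <;> simp [hij]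
  rw [← h2] at h1
  exact h1.symm.le.trans (Matrix.rank_mul_le_right _ _)

end PolynomialMatrices

/-! ### Differential operators -/

section DifferentialOperators

open Polynomial

variable {d : ℕ}

/-- The polynomial in `τ` obtained from a polynomial in `ξ_1, …, ξ_d, τ` by putting `ξ = ζ`. -/
def specialize (ζ : Fin d → ℂ) : MvPolynomial (Fin (d + 1)) ℂ →ₐ[ℂ] ℂ[X] :=
  MvPolynomial.aeval (Fin.snoc (α := fun _ => ℂ[X]) (fun k => C (ζ k)) X)

lemma eval_specialize (ζ : Fin d → ℂ) (t : ℂ) (p : MvPolynomial (Fin (d + 1)) ℂ) :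
    eval t (specialize ζ p) = MvPolynomial.eval (Fin.snoc (α := fun _ => ℂ) ζ t) p := by
  have : ((Polynomial.aeval t).comp (specialize ζ)) =
      MvPolynomial.aeval (Fin.snoc (α := fun _ => ℂ) ζ t) := by
    refine MvPolynomial.algHom_ext fun i => ?_
    refine Fin.lastCases ?_ (fun k => ?_) i <;> simp [specialize]
  have h := DFunLike.congr_fun this p
  simpa [Polynomial.aeval_def, MvPolynomial.aeval_def] using h

lemma map_specialize_eval {m n : ℕ} (M : Matrix (Fin m) (Fin n) (MvPolynomial (Fin (d + 1)) ℂ))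
    (ζ : Fin d → ℂ) (t : ℂ) : (M.map (specialize ζ)).map (eval t) = evalMatrix M ζ t := by
  ext i j
  exact eval_specialize ζ t _

lemma direction_castSucc (k : Fin d) :
    direction (d := d) k.castSucc = ((Pi.single k 1, 0) : SpaceTime d) := by
  simp [direction]

lemma direction_last : direction (Fin.last d) = ((0, 1) : SpaceTime d) := by
  simp [direction]

/-- A linear map that turns `∂/∂x_k` into multiplication by `ζ_k` and `∂/∂t` into `D` turns
`p(∂/∂x, ∂/∂t)` into `p(ζ, D)`. The first two conditions are only required on a set `P` of
distributions that is stable under differentiation. -/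
lemma map_diffOp {L : Type*} [AddCommGroup L] [Module ℂ L] {P : Set (Distr (SpaceTime d))}
    (hP : ∀ w ∈ P, ∀ i, ∂_{direction (d := d) i} w ∈ P) (U : Distr (SpaceTime d) →ₗ[ℂ] L)
    (D : Module.End ℂ L) {ζ : Fin d → ℂ}
    (hk : ∀ w ∈ P, ∀ k : Fin d, U (∂_{direction k.castSucc} w) = ζ k • U w)
    (ht : ∀ w ∈ P, U (∂_{direction (Fin.last d)} w) = D (U w))
    (p : MvPolynomial (Fin (d + 1)) ℂ) {w : Distr (SpaceTime d)} (hw : w ∈ P) :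
    U (diffOp p w) = aeval D (specialize ζ p) (U w) := by
  let ξ : Fin (d + 1) → ℂ[X] := Fin.snoc (α := fun _ => ℂ[X]) (fun k => C (ζ k)) X
  let A (i : Fin (d + 1)) := LineDeriv.lineDerivOpCLM ℝ (Distr (SpaceTime d)) (direction i)
  have h1 : ∀ i, ∀ w ∈ P, U (A i w) = aeval D (ξ i) (U w) := fun i w hw => by
    refine Fin.lastCases ?_ (fun k => ?_) i
    · refine (ht w hw).trans ?_
      simp [ξ]
    · refine (hk w hw k).trans ?_
      simp [ξ]
  have h2 : ∀ i k, ∀ w ∈ P, (A i ^ k) w ∈ P ∧ U ((A i ^ k) w) = aeval D (ξ i ^ k) (U w) := by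
    intro i k
    induction k with
    | zero => simp
    | succ k ih =>
      intro w hw
      have hA : A i w ∈ P := hP w hw i
      rw [pow_succ]
      refine ⟨(ih _ hA).1, ((ih _ hA).2).trans ?_⟩
      rw [h1 i w hw, pow_succ, map_mul, Module.End.mul_apply]
  have h3 : ∀ (α : Fin (d + 1) →₀ ℕ) (l : List (Fin (d + 1))), ∀ w ∈ P,
      (l.map fun i => A i ^ α i).prod w ∈ P ∧
        U ((l.map fun i => A i ^ α i).prod w) = aeval D (l.map fun i => ξ i ^ α i).prod (U w) := by
    intro α l
    induction l with
    | nil => simp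
    | cons i l ih =>
      intro w hw
      rw [List.map_cons, List.prod_cons, List.map_cons, List.prod_cons]
      have h4 := h2 i (α i) _ (ih w hw).1
      refine ⟨h4.1, h4.2.trans ?_⟩
      rw [(ih w hw).2, map_mul, Module.End.mul_apply]
  have h5 : ∀ α, U (partialDeriv α w) = aeval D (∏ i, ξ i ^ α i) (U w) := fun α => by
    rw [partialDeriv, List.ofFn_eq_map, (h3 α _ w hw).2, ← List.ofFn_eq_map, List.prod_ofFn]
  rw [diffOp, map_sum, specialize, MvPolynomial.aeval_def, MvPolynomial.eval₂_eq', map_sum,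
    LinearMap.sum_apply]
  refine Finset.sum_congr rfl fun α _ => ?_
  rw [map_smul, h5, map_mul, Module.End.mul_apply, Polynomial.algebraMap_eq, aeval_C,
    Module.algebraMap_end_apply]

end DifferentialOperators

/-! ### Fourier coefficients on the unit cube -/

section FourierCoefficients

open UnitAddTorus

variable {d : ℕ}

/-- The half-open unit cube with lower corner `b`. -/
def unitCube (b : Fin d → ℝ) : Set (Fin d → ℝ) := {y | ∀ i, y i ∈ Set.Ioc (b i) (b i + 1)}

lemma unitCube_subset_Icc (b : Fin d → ℝ) : unitCube b ⊆ Set.Icc b (b + 1) :=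
  fun _ hy => ⟨fun i => (hy i).1.le, fun i => (hy i).2⟩

lemma measurableSet_unitCube (b : Fin d → ℝ) : MeasurableSet (unitCube b) := by
  have : unitCube b = Set.pi Set.univ fun i => Set.Ioc (b i) (b i + 1) := by
    ext
    simp [unitCube]
  rw [this]
  exact .univ_pi fun _ => measurableSet_Ioc

lemma integrableOn_unitCube {f : (Fin d → ℝ) → ℂ} (hf : Continuous f) (b : Fin d → ℝ) :
    IntegrableOn f (unitCube b) :=
  (hf.continuousOn.integrableOn_compact isCompact_Icc).mono_set (unitCube_subset_Icc b)

/-- The character `y ↦ exp (2 π i z · y)` of `ℝ^d`, for `z ∈ ℤ^d`. -/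
def latticeChar (z : Fin d → ℤ) (y : Fin d → ℝ) : ℂ := mFourier z fun i => (y i : UnitAddCircle)

lemma latticeChar_eq_exp (z : Fin d → ℤ) (y : Fin d → ℝ) :
    latticeChar z y = Complex.exp (2 * Real.pi * Complex.I * (∑ i, z i * y i : ℝ)) := by
  simp only [latticeChar, mFourier, ContinuousMap.coe_mk, fourier_coe_apply]
  rw [← Complex.exp_sum, Complex.ofReal_sum, Finset.mul_sum]
  congr 1
  refine Finset.sum_congr rfl fun i _ => ?_
  push_cast
  ring

lemma latticeChar_add (z : Fin d → ℤ) (x y : Fin d → ℝ) :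
    latticeChar z (x + y) = latticeChar z x * latticeChar z y := by
  rw [latticeChar_eq_exp, latticeChar_eq_exp, latticeChar_eq_exp, ← Complex.exp_add, ← mul_add,
    ← Complex.ofReal_add, ← Finset.sum_add_distrib]
  simp [mul_add]

lemma latticeChar_neg_mul (z : Fin d → ℤ) (y : Fin d → ℝ) :
    latticeChar z y * latticeChar (-z) y = 1 := by
  rw [latticeChar_eq_exp, latticeChar_eq_exp, ← Complex.exp_add, ← mul_add,
    ← Complex.ofReal_add, ← Finset.sum_add_distrib]
  simp

lemma continuous_latticeChar (z : Fin d → ℤ) : Continuous (latticeChar z) :=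
  (mFourier z).continuous.comp
    (continuous_pi fun i => (AddCircle.continuous_mk' 1).comp (continuous_apply i))

/-- The Fourier coefficient with index `z` of a function on `ℝ^d` with periods `1` in all
coordinates, as an integral over the unit cube. -/
def cubeCoeff (z : Fin d → ℤ) (H : (Fin d → ℝ) → ℂ) : ℂ :=
  ∫ y in unitCube 0, latticeChar (-z) y * H y

variable {H : (Fin d → ℝ) → ℂ}

/-- A continuous function on `ℝ^d` with periods `1` in all coordinates descends to the torus. -/
lemma exists_continuousMap_torus (hH : Continuous H)
    (hper : ∀ k y, H (y + Pi.single k 1) = H y) :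
    ∃ f : C(UnitAddTorus (Fin d), ℂ),
      ∀ y : Fin d → ℝ, f (fun i => (y i : UnitAddCircle)) = H y := by
  have hq : IsOpenQuotientMap (Pi.map fun (_ : Fin d) (t : ℝ) => (t : UnitAddCircle)) :=
    .piMap fun _ => QuotientAddGroup.isOpenQuotientMap_mk
  have hint : ∀ (k : Fin d) (n : ℤ) y, H (y + n • Pi.single k 1) = H y := by
    intro k n
    induction n using Int.induction_on with
    | zero => simp
    | succ n ih =>
      intro y
      rw [add_zsmul, one_zsmul, ← add_assoc, hper, ih]
    | pred n ih =>
      intro y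
      rw [← hper k, sub_zsmul, one_zsmul, add_assoc, neg_add_cancel_right, ih]
  have hsum : ∀ (n : Fin d → ℤ) (s : Finset (Fin d)) (y : Fin d → ℝ),
      H (y + ∑ k ∈ s, n k • Pi.single k 1) = H y := by
    intro n s
    induction s using Finset.induction_on with
    | empty => simp
    | insert k s hk ih =>
      intro y
      rw [Finset.sum_insert hk, ← add_assoc, ih, hint]
  have hfac : Function.FactorsThrough H
      (Pi.map fun (_ : Fin d) (t : ℝ) => (t : UnitAddCircle)) := by
    intro x y hxy
    have h1 : ∀ i, ∃ n : ℤ, x i = y i + n := fun i => by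
      obtain ⟨n, hn⟩ := AddSubgroup.mem_zmultiples_iff.1
        (QuotientAddGroup.eq_iff_sub_mem.1 (congrFun hxy i))
      refine ⟨n, ?_⟩
      rw [zsmul_eq_mul, mul_one] at hn
      linarith
    choose n hn using h1
    rw [← hsum n Finset.univ y]
    congr 1
    ext i
    rw [hn i, Pi.add_apply, Finset.sum_apply]
    simp [Pi.single_apply]
  let q : C(Fin d → ℝ, UnitAddTorus (Fin d)) := ⟨_, hq.continuous⟩
  have hq' : IsQuotientMap q := hq.isQuotientMap
  exact ⟨hq'.lift ⟨H, hH⟩ hfac, DFunLike.congr_fun (hq'.lift_comp ⟨H, hH⟩ hfac)⟩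

lemma mFourierCoeff_eq_setIntegral_unitCube {f : C(UnitAddTorus (Fin d), ℂ)}
    (hf : ∀ y : Fin d → ℝ, f (fun i => (y i : UnitAddCircle)) = H y) (z : Fin d → ℤ)
    (b : Fin d → ℝ) :
    mFourierCoeff f z = ∫ y in unitCube b, latticeChar (-z) y * H y := by
  rw [mFourierCoeff_eq_integral f z b]
  simp only [hf]
  rfl

/-- A continuous function all of whose Fourier coefficients vanish is zero, because its Fourier
series is summable and hence converges to it. -/
lemma eq_zero_of_cubeCoeff_eq_zero (hH : Continuous H)
    (hper : ∀ k y, H (y + Pi.single k 1) = H y) (h : ∀ z, cubeCoeff z H = 0) : H = 0 := by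
  obtain ⟨f, hf⟩ := exists_continuousMap_torus hH hper
  have hz : mFourierCoeff f = 0 := funext fun z =>
    (mFourierCoeff_eq_setIntegral_unitCube hf z 0).trans (h z)
  have hs := hasSum_mFourier_series_of_summable (f := f) (by rw [hz]; exact summable_zero)
  have h0 : ∀ z, mFourierCoeff f z • (mFourier z : C(UnitAddTorus (Fin d), ℂ)) = 0 := fun z => by
    ext x
    rw [hz]
    exact zero_mul _
  simp only [h0] at hs
  have hf0 : f = 0 := hs.unique hasSum_zero
  ext y
  rw [← hf, hf0]
  rfl

lemma cubeCoeff_comp_add (hH : Continuous H) (hper : ∀ k y, H (y + Pi.single k 1) = H y)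
    (z : Fin d → ℤ) (b : Fin d → ℝ) :
    cubeCoeff z (fun y => H (y + b)) = latticeChar z b * cubeCoeff z H := by
  obtain ⟨f, hf⟩ := exists_continuousMap_torus hH hper
  have h1 : cubeCoeff z H = ∫ y in unitCube b, latticeChar (-z) y * H y := by
    rw [← mFourierCoeff_eq_setIntegral_unitCube hf z b,
      mFourierCoeff_eq_setIntegral_unitCube hf z 0]
    rfl
  have h2 : (fun y => y + b) ⁻¹' unitCube b = unitCube 0 := by
    ext y
    simp only [unitCube, Set.mem_preimage, Set.mem_ofPred_eq, Pi.add_apply, Set.mem_Ioc,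
      Pi.zero_apply, zero_add]
    refine forall_congr' fun i => and_congr ?_ ?_
    · exact lt_add_iff_pos_left _
    · rw [add_comm, add_le_add_iff_left]
  rw [h1, ← (measurePreserving_add_right volume b).setIntegral_preimage_emb
    (MeasurableEquiv.addRight b).measurableEmbedding, h2, cubeCoeff, ← integral_const_mul]
  refine integral_congr_ae (.of_forall fun y => ?_)
  simp only
  rw [latticeChar_add]
  linear_combination (-latticeChar (-z) y * H (y + b)) * latticeChar_neg_mul z b

/-- Differentiation along `b` multiplies the Fourier coefficient with index `z` by
`2 π i z · b`, as one sees by differentiating the coefficient `exp (2 π i s z · b) cubeCoeff z H`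
of the translate `H(· + s b)` in `s`. -/
lemma cubeCoeff_lineDeriv (hH : Continuous H) (hper : ∀ k y, H (y + Pi.single k 1) = H y)
    {G : (Fin d → ℝ) → ℂ} (hG : Continuous G) {b : Fin d → ℝ}
    (hd : ∀ (y : Fin d → ℝ) (s : ℝ), HasDerivAt (fun r : ℝ => H (y + r • b)) (G (y + s • b)) s)
    (z : Fin d → ℤ) :
    cubeCoeff z G = 2 * Real.pi * Complex.I * (∑ i, z i * b i : ℝ) * cubeCoeff z H := by
  have hc := continuous_latticeChar (-z)
  have hcont : ∀ s : ℝ, Continuous fun y => latticeChar (-z) y * H (y + s • b) := fun s =>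
    hc.mul (hH.comp (by fun_prop))
  have hcG : Continuous fun p : (Fin d → ℝ) × ℝ => latticeChar (-z) p.1 * G (p.1 + p.2 • b) :=
    (hc.comp continuous_fst).mul (hG.comp (by fun_prop))
  obtain ⟨C, hC⟩ := ((isCompact_Icc (a := (0 : Fin d → ℝ)) (b := 0 + 1)).prod
    (isCompact_Icc (a := (-1 : ℝ)) (b := 1))).exists_bound_of_continuousOn hcG.continuousOn
  have h1 : HasDerivAt (fun s : ℝ => cubeCoeff z fun y => H (y + s • b))
      (∫ y in unitCube 0, latticeChar (-z) y * G (y + (0 : ℝ) • b)) 0 := by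
    refine (hasDerivAt_integral_of_dominated_loc_of_deriv_le
      (F := fun s y => latticeChar (-z) y * H (y + s • b))
      (F' := fun s y => latticeChar (-z) y * G (y + s • b))
      (bound := fun _ => C) (Metric.ball_mem_nhds (0 : ℝ) one_pos)
      (.of_forall fun s => (hcont s).aestronglyMeasurable) (integrableOn_unitCube (hcont 0) 0)
      (hcG.comp (continuous_id.prodMk continuous_const)).aestronglyMeasurable ?_
      ((integrableOn_const isCompact_Icc.measure_lt_top.ne).mono_set
        (unitCube_subset_Icc 0)) ?_).2
    · refine (ae_restrict_iff' (measurableSet_unitCube 0)).2 (.of_forall fun y hy s hs => ?_)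
      refine hC (y, s) ⟨unitCube_subset_Icc 0 hy, ?_⟩
      rw [Metric.mem_ball, dist_zero_right, Real.norm_eq_abs, abs_lt] at hs
      exact ⟨hs.1.le, hs.2.le⟩
    · exact .of_forall fun y s _ => (hd y s).const_mul _
  simp only [zero_smul, add_zero] at h1
  have h2 : (fun s : ℝ => cubeCoeff z fun y => H (y + s • b)) = fun s : ℝ =>
      Complex.exp (2 * Real.pi * Complex.I * (∑ i, z i * b i : ℝ) * s) * cubeCoeff z H := by
    ext s
    rw [cubeCoeff_comp_add hH hper, latticeChar_eq_exp]
    congr 2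
    rw [mul_assoc _ _ (s : ℂ)]
    congr 1
    push_cast
    rw [Finset.sum_mul]
    refine Finset.sum_congr rfl fun i _ => ?_
    simp
    ring
  rw [h2] at h1
  set κ : ℂ := 2 * Real.pi * Complex.I * (∑ i, z i * b i : ℝ)
  have h3 : HasDerivAt (fun s : ℝ => Complex.exp (κ * s) * cubeCoeff z H)
      (κ * cubeCoeff z H) 0 := by
    have := (((Complex.hasDerivAt_exp (κ * (0 : ℝ))).comp ((0 : ℝ) : ℂ)
      ((hasDerivAt_id ((0 : ℝ) : ℂ)).const_mul κ)).comp_ofReal).mul_const (cubeCoeff z H)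
    simpa using this
  exact h1.unique h3

end FourierCoefficients

/-! ### Spatial periodicity -/

section SpatialPeriodicity

variable {d : ℕ} {a : Fin d → Space d}

lemma translateDistr_lineDerivOp {E : Type} [NormedAddCommGroup E] [NormedSpace ℝ E] (y b : E)
    (w : Distr E) : translateDistr y (∂_{b} w : Distr E) = ∂_{b} (translateDistr y w) := by
  ext Φ
  rw [translateDistr_apply, Distribution.lineDerivOp_apply_apply,
    Distribution.lineDerivOp_apply_apply, translateDistr_apply, map_neg, map_neg, map_neg,
    translateTest_lineDerivOp]

/-- Spatial periodicity can be tested on all test functions, not only on tensor products. -/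
lemma mem_spatiallyPeriodicDistr_iff {w : Distr (SpaceTime d)} :
    w ∈ spatiallyPeriodicDistr a ↔
      ∀ k, translateDistr ((a k, 0) : SpaceTime d) w = w := by
  have h : ∀ k φ ψ, translateTest ((a k, 0) : SpaceTime d) (tensorTest φ ψ) =
      tensorTest φ (translateTest (a k) ψ) := fun k φ ψ => by
    rw [translateTest_tensorTest, translateTest_zero]
  refine ⟨fun hw k => sub_eq_zero.1 (distr_eq_zero_of_tensorTest _ fun φ ψ => ?_),
    fun hw φ k => ?_⟩
  · have h1 := DFunLike.congr_fun (hw φ k) ψ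
    rw [translateDistr_apply, slice_apply, slice_apply] at h1
    change translateDistr ((a k, 0) : SpaceTime d) w (tensorTest φ ψ) - w (tensorTest φ ψ) = 0
    rw [translateDistr_apply, h, h1, sub_self]
  · ext ψ
    rw [translateDistr_apply, slice_apply, slice_apply, ← h, ← translateDistr_apply, hw]

lemma lineDerivOp_mem_spatiallyPeriodicDistr {w : Distr (SpaceTime d)}
    (hw : w ∈ spatiallyPeriodicDistr a) (b : SpaceTime d) :
    (∂_{b} w : Distr (SpaceTime d)) ∈ spatiallyPeriodicDistr a := by
  rw [mem_spatiallyPeriodicDistr_iff] at hw ⊢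
  intro k
  rw [translateDistr_lineDerivOp, hw]

/-- The point of `ℝ^{d+1}` at time `0` whose coordinates in the basis `a` are `y`. -/
def latticePoint (a : Fin d → Space d) (y : Fin d → ℝ) : SpaceTime d := (∑ i, y i • a i, 0)

lemma latticePoint_add (y z : Fin d → ℝ) :
    latticePoint a (y + z) = latticePoint a y + latticePoint a z := by
  simp [latticePoint, add_smul, Finset.sum_add_distrib]

lemma latticePoint_smul (r : ℝ) (y : Fin d → ℝ) :
    latticePoint a (r • y) = r • latticePoint a y := by
  simp [latticePoint, mul_smul, Finset.smul_sum]

lemma latticePoint_single (k : Fin d) :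
    latticePoint a (Pi.single k 1) = ((a k, 0) : SpaceTime d) := by
  simp [latticePoint, Pi.single_apply]

lemma continuous_latticePoint : Continuous (latticePoint a) := by
  unfold latticePoint
  fun_prop

lemma isUnit_det_of_linearIndependent (ha : LinearIndependent ℝ a) :
    IsUnit (Matrix.of a).det := by
  rw [← Matrix.isUnit_iff_isUnit_det]
  exact Matrix.linearIndependent_rows_iff_isUnit.1 ha

/-- The coordinates of the standard basis vectors in the basis `a` are the rows of the inverse of
the matrix with rows `a`. -/
lemma latticePoint_inv_row (ha : LinearIndependent ℝ a) (k : Fin d) :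
    latticePoint a ((Matrix.of a)⁻¹ k) = direction k.castSucc := by
  rw [direction_castSucc]
  refine Prod.ext ?_ rfl
  ext l
  have h := congrFun (congrFun (Matrix.nonsing_inv_mul _ (isUnit_det_of_linearIndependent ha)) k) l
  rw [Matrix.mul_apply] at h
  simp only [latticePoint, Finset.sum_apply, Pi.smul_apply, smul_eq_mul]
  refine h.trans ?_
  rw [Matrix.one_apply, Pi.single_apply]
  simp [eq_comm]

lemma continuous_orbit (w : Distr (SpaceTime d)) (Φ : Test (SpaceTime d)) :
    Continuous fun y => w (translateTest (latticePoint a y) Φ) :=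
  (continuous_distr_translateTest w Φ).comp continuous_latticePoint

lemma orbit_add_single {w : Distr (SpaceTime d)} (hw : w ∈ spatiallyPeriodicDistr a)
    (Φ : Test (SpaceTime d)) (k : Fin d) (y : Fin d → ℝ) :
    w (translateTest (latticePoint a (y + Pi.single k 1)) Φ) =
      w (translateTest (latticePoint a y) Φ) := by
  rw [latticePoint_add, latticePoint_single, add_comm, ← translateTest_add, ← translateDistr_apply,
    mem_spatiallyPeriodicDistr_iff.1 hw k]

end SpatialPeriodicity

/-! ### Fourier coefficients of spatially periodic distributions -/

section FourierFunctionals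

variable {d : ℕ}

lemma tensorTest_add (φ φ' : Test ℝ) (ψ : Test (Space d)) :
    tensorTest (φ + φ') ψ = tensorTest φ ψ + tensorTest φ' ψ := by
  ext p
  exact mul_add _ _ _

lemma tensorTest_smul (r : ℝ) (φ : Test ℝ) (ψ : Test (Space d)) :
    tensorTest (r • φ) ψ = r • tensorTest φ ψ := by
  ext p
  exact mul_left_comm _ _ _

lemma lineDerivOp_tensorTest (φ : Test ℝ) (ψ : Test (Space d)) :
    (∂_{direction (Fin.last d)} (tensorTest φ ψ) : Test (SpaceTime d)) =
      tensorTest (∂_{(1 : ℝ)} φ) ψ := by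
  ext p
  rw [tensorTest_apply, lineDerivOp_test_apply, lineDerivOp_test_apply, direction_last]
  have h1 : HasFDerivAt (fun p : SpaceTime d => ψ p.1)
      ((fderiv ℝ ψ p.1).comp (ContinuousLinearMap.fst ℝ (Space d) ℝ)) p :=
    ((ψ.contDiff.differentiable (by simp)) p.1).hasFDerivAt.comp p hasFDerivAt_fst
  have h2 : HasFDerivAt (fun p : SpaceTime d => φ p.2)
      ((fderiv ℝ φ p.2).comp (ContinuousLinearMap.snd ℝ (Space d) ℝ)) p :=
    ((φ.contDiff.differentiable (by simp)) p.2).hasFDerivAt.comp p hasFDerivAt_snd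
  have h3 : fderiv ℝ (tensorTest φ ψ) p = _ := (h1.mul h2).fderiv
  rw [h3]
  simp

lemma tsupport_translateTest_tensorTest_subset {φ : Test ℝ} (hφ : tsupport φ ⊆ Set.Iio 0)
    (ψ : Test (Space d)) (x : Space d) :
    tsupport (translateTest ((x, 0) : SpaceTime d) (tensorTest φ ψ)) ⊆ {p | p.2 < 0} := by
  have hc : IsClosed {p : SpaceTime d | p.2 ∈ tsupport φ} :=
    (isClosed_tsupport φ).preimage continuous_snd
  refine (closure_minimal (fun p hp => ?_) hc).trans fun p hp => hφ hp
  have h1 : (translateTest ((x, 0) : SpaceTime d) (tensorTest φ ψ)) p =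
      ψ (p.1 + x) * φ (p.2 + 0) := rfl
  rw [Function.mem_support, h1, add_zero] at hp
  exact subset_closure (right_ne_zero_of_mul hp)

/-- The functional `φ ↦ ⟨w, ψ ⊗ φ⟩` on the test functions of time. -/
def timeFunctional (ψ : Test (Space d)) : Distr (SpaceTime d) →ₗ[ℂ] (Test ℝ →ₗ[ℝ] ℂ) :=
  LinearMap.mk₂' ℂ ℝ (fun w φ => w (tensorTest φ ψ)) (fun _ _ _ => rfl) (fun _ _ _ => rfl)
    (fun w φ φ' => by rw [tensorTest_add, map_add])
    (fun r w φ => by rw [tensorTest_smul, map_smul])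

/-- For `z ∈ ℤ^d`, the functional that sends a test function `φ` of time to the Fourier coefficient
with index `z` of `y ↦ ⟨w, ψ(· + ∑ y_i a_i) ⊗ φ⟩`. -/
def fourierFunctional (a : Fin d → Space d) (z : Fin d → ℤ) (ψ : Test (Space d)) :
    Distr (SpaceTime d) →ₗ[ℂ] (Test ℝ →ₗ[ℝ] ℂ) :=
  have hint (w : Distr (SpaceTime d)) (Φ : Test (SpaceTime d)) :
      IntegrableOn (fun y => latticeChar (-z) y * w (translateTest (latticePoint a y) Φ))
        (unitCube 0) :=
    integrableOn_unitCube ((continuous_latticeChar (-z)).mul (continuous_orbit w Φ)) 0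
  LinearMap.mk₂' ℂ ℝ
    (fun w φ => cubeCoeff z fun y => w (translateTest (latticePoint a y) (tensorTest φ ψ)))
    (fun w w' φ => by
      rw [cubeCoeff, cubeCoeff, cubeCoeff, ← integral_add (hint _ _) (hint _ _)]
      exact integral_congr_ae (.of_forall fun y => mul_add _ _ _))
    (fun c w φ => by
      rw [cubeCoeff, cubeCoeff, ← integral_smul]
      exact integral_congr_ae (.of_forall fun y => mul_left_comm _ _ _))
    (fun w φ φ' => by
      rw [cubeCoeff, cubeCoeff, cubeCoeff, ← integral_add (hint _ _) (hint _ _)]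
      refine integral_congr_ae (.of_forall fun y => ?_)
      simp only [tensorTest_add, map_add, mul_add])
    (fun r w φ => by
      rw [cubeCoeff, cubeCoeff, ← integral_smul]
      refine integral_congr_ae (.of_forall fun y => ?_)
      simp only [tensorTest_smul, map_smul]
      exact mul_smul_comm _ _ _)

lemma fourierFunctional_apply (a : Fin d → Space d) (z : Fin d → ℤ) (ψ : Test (Space d))
    (w : Distr (SpaceTime d)) (φ : Test ℝ) : fourierFunctional a z ψ w φ =
      cubeCoeff z fun y => w (translateTest (latticePoint a y) (tensorTest φ ψ)) := rfl

lemma cubeCoeff_neg (z : Fin d → ℤ) (H : (Fin d → ℝ) → ℂ) :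
    cubeCoeff z (fun y => -H y) = -cubeCoeff z H := by
  simp only [cubeCoeff, mul_neg, integral_neg]

lemma lineDerivOp_translateTest_apply (w : Distr (SpaceTime d)) (b p : SpaceTime d)
    (Φ : Test (SpaceTime d)) :
    (∂_{b} w : Distr (SpaceTime d)) (translateTest p Φ) =
      -w (translateTest p (∂_{b} Φ : Test (SpaceTime d))) := by
  rw [Distribution.lineDerivOp_apply_apply, map_neg, translateTest_lineDerivOp]

lemma fourierFunctional_time (a : Fin d → Space d) (z : Fin d → ℤ) (ψ : Test (Space d))
    (w : Distr (SpaceTime d)) :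
    fourierFunctional a z ψ (∂_{direction (Fin.last d)} w) =
      functionalDeriv (fourierFunctional a z ψ w) := by
  ext φ
  rw [functionalDeriv_apply, fourierFunctional_apply, fourierFunctional_apply, ← cubeCoeff_neg]
  simp only [lineDerivOp_translateTest_apply, lineDerivOp_tensorTest]

lemma timeFunctional_time (ψ : Test (Space d)) (w : Distr (SpaceTime d)) :
    timeFunctional ψ (∂_{direction (Fin.last d)} w) = functionalDeriv (timeFunctional ψ w) := by
  ext φ
  change (∂_{direction (Fin.last d)} w : Distr (SpaceTime d)) (tensorTest φ ψ) =
    -w (tensorTest (∂_{(1 : ℝ)} φ) ψ)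
  rw [Distribution.lineDerivOp_apply_apply, map_neg, lineDerivOp_tensorTest]

/-- On spatially periodic distributions, `fourierFunctional` turns `∂/∂x_k` into multiplication by
`-2 π i v_k`, where `v = A⁻¹ z`. The sign appears because pairing `w` with `Φ(· + b)` amounts
to pairing `w(· - b)` with `Φ`. -/
lemma fourierFunctional_space {a : Fin d → Space d} (ha : LinearIndependent ℝ a)
    (z : Fin d → ℤ) (ψ : Test (Space d)) {w : Distr (SpaceTime d)}
    (hw : w ∈ spatiallyPeriodicDistr a) (k : Fin d) :
    fourierFunctional a z ψ (∂_{direction k.castSucc} w) =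
      (-(2 * Real.pi * Complex.I * ((Matrix.of a)⁻¹.mulVec (fun i => (z i : ℝ)) k : ℝ)) : ℂ) •
        fourierFunctional a z ψ w := by
  ext φ
  rw [LinearMap.smul_apply, fourierFunctional_apply, fourierFunctional_apply]
  simp only [lineDerivOp_translateTest_apply]
  rw [cubeCoeff_neg, cubeCoeff_lineDeriv (b := (Matrix.of a)⁻¹ k) (continuous_orbit w _)
    (orbit_add_single hw (tensorTest φ ψ)) (continuous_orbit w _) (fun y s => ?_) z]
  · rw [neg_smul, smul_eq_mul]
    congr 4
    rw [Matrix.mulVec, dotProduct]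
    exact Finset.sum_congr rfl fun i _ => mul_comm _ _
  · simp only [latticePoint_add, latticePoint_smul, latticePoint_inv_row ha]
    exact hasDerivAt_distr_translateTest w _ _ _ s

lemma vanishesOnPast_fourierFunctional (a : Fin d → Space d) (z : Fin d → ℤ)
    (ψ : Test (Space d)) {w : Distr (SpaceTime d)}
    (hw : Distribution.IsVanishingOn w {p : SpaceTime d | p.2 < 0}) :
    VanishesOnPast (fourierFunctional a z ψ w) := fun φ hφ => by
  rw [fourierFunctional_apply, cubeCoeff]
  refine integral_eq_zero_of_ae (.of_forall fun y => ?_)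
  simp only [Pi.zero_apply, latticePoint]
  rw [hw _ (tsupport_translateTest_tensorTest_subset hφ ψ _), mul_zero]

lemma vanishesOnPast_timeFunctional (ψ : Test (Space d)) {w : Distr (SpaceTime d)}
    (hw : Distribution.IsVanishingOn w {p : SpaceTime d | p.2 < 0}) :
    VanishesOnPast (timeFunctional ψ w) := fun φ hφ => by
  have h := hw _ (tsupport_translateTest_tensorTest_subset hφ ψ 0)
  rw [show ((0, 0) : SpaceTime d) = 0 from rfl, translateTest_zero] at h
  exact h

/-- A spatially periodic distribution is zero if all its Fourier coefficients are. -/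
lemma eq_zero_of_fourierFunctional_eq_zero {a : Fin d → Space d} {w : Distr (SpaceTime d)}
    (hw : w ∈ spatiallyPeriodicDistr a) (h : ∀ z ψ, fourierFunctional a z ψ w = 0) : w = 0 := by
  refine distr_eq_zero_of_tensorTest w fun φ ψ => ?_
  have h1 := eq_zero_of_cubeCoeff_eq_zero (continuous_orbit w (tensorTest φ ψ))
    (orbit_add_single hw (tensorTest φ ψ)) fun z => by
      rw [← fourierFunctional_apply, h, LinearMap.zero_apply]
  have h2 := congrFun h1 0
  have h3 : latticePoint a 0 = 0 := by simp [latticePoint]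
  simpa [h3, translateTest_zero] using h2

end FourierFunctionals

/-! ### Autonomy -/

section Autonomy

open Polynomial

variable {d m n : ℕ} {a : Fin d → Space d}

/-- A left multiple `q • 1` of the matrix `N` decouples the system `N(D) u = 0`. -/
lemma aeval_apply_eq_zero_of_mul_eq_smul_one {L : Type*} [AddCommGroup L] [Module ℂ L]
    (D : Module.End ℂ L) {N : Matrix (Fin m) (Fin n) ℂ[X]} {B : Matrix (Fin n) (Fin m) ℂ[X]}
    {q : ℂ[X]} (hB : B * N = q • 1) {u : Fin n → L} (h : ∀ i, ∑ j, aeval D (N i j) (u j) = 0)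
    (l : Fin n) : aeval D q (u l) = 0 := by
  have h1 : ∑ j, aeval D ((B * N) l j) (u j) = 0 := by
    simp only [Matrix.mul_apply, map_sum, map_mul, LinearMap.sum_apply, Module.End.mul_apply]
    rw [Finset.sum_comm]
    simp only [← map_sum, h, map_zero, Finset.sum_const_zero]
  rw [hB, Finset.sum_eq_single l] at h1
  · simpa using h1
  · intro j _ hj
    simp [Matrix.one_apply_ne' hj]
  · simp

/-- Full rank at all frequencies implies autonomy. -/
lemma isAutonomous_of_rank (ha : LinearIndependent ℝ a)
    {M : Matrix (Fin m) (Fin n) (MvPolynomial (Fin (d + 1)) ℂ)}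
    (h : ∀ z : Fin d → ℤ, ∃ t, (evalMatrix M (fun k => 2 * Real.pi * Complex.I *
      ((Matrix.of a)⁻¹.mulVec (fun i => (z i : ℝ)) k : ℝ)) t).rank = n) :
    IsAutonomous (behaviour (spatiallyPeriodicDistr a) M) := by
  rintro w ⟨hw, hM⟩ hpast
  ext1 l
  refine eq_zero_of_fourierFunctional_eq_zero (hw l) fun z ψ => ?_
  -- `fourierFunctional a z` turns `∂/∂x` into `-2 π i A⁻¹ z`, the frequency that belongs to `-z`.
  obtain ⟨t, ht⟩ := h (-z)
  set ζ : Fin d → ℂ := fun k => 2 * Real.pi * Complex.I *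
      ((Matrix.of a)⁻¹.mulVec (fun i => ((-z) i : ℝ)) k : ℝ) with hζ
  have hζ' : ∀ k, ζ k =
      -(2 * Real.pi * Complex.I * ((Matrix.of a)⁻¹.mulVec (fun i => (z i : ℝ)) k : ℝ)) := by
    intro k
    have : (fun i => (((-z) i : ℤ) : ℝ)) = -fun i => (z i : ℝ) := by
      ext i
      simp
    simp only [hζ]
    rw [this, Matrix.mulVec_neg, Pi.neg_apply, Complex.ofReal_neg, mul_neg]
  rw [← map_specialize_eval] at ht
  obtain ⟨B, q, hq, hB⟩ := exists_mul_eq_smul_one ht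
  refine (vanishesOnPast_fourierFunctional a z ψ (hpast l)).eq_zero_of_aeval_eq_zero hq ?_
  refine aeval_apply_eq_zero_of_mul_eq_smul_one functionalDeriv hB
    (u := fun j => fourierFunctional a z ψ (w j)) (fun i => ?_) l
  have h1 := congrArg (fourierFunctional a z ψ) (hM i)
  rw [map_sum, map_zero] at h1
  refine Eq.trans (Finset.sum_congr rfl fun j _ => ?_) h1
  exact (map_diffOp (P := spatiallyPeriodicDistr a)
    (fun v hv i => lineDerivOp_mem_spatiallyPeriodicDistr hv _) (fourierFunctional a z ψ)
    functionalDeriv (fun v hv k => by rw [fourierFunctional_space ha z ψ hv k, hζ'])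
    (fun v _ => fourierFunctional_time a z ψ v) (M i j) (hw j)).symm

end Autonomy

/-! ### Waves that start at time zero -/

section Waves

open Polynomial

variable {d m n : ℕ} {a : Fin d → Space d}

/-- The wave `exp (2 π i v · x) θ(t)`, where `θ` is smooth, zero for `t ≤ 0` and positive for
`t > 0`. -/
def futureWave (v : Fin d → ℝ) (p : SpaceTime d) : ℂ :=
  Complex.exp (2 * Real.pi * Complex.I * (∑ k, v k * p.1 k : ℝ)) * (expNegInvGlue p.2 : ℂ)

lemma contDiff_futureWave (v : Fin d → ℝ) : ContDiff ℝ (⊤ : ℕ∞) (futureWave v) := by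
  have h1 : ContDiff ℝ (⊤ : ℕ∞) fun p : SpaceTime d => (∑ k, v k * p.1 k : ℝ) := by fun_prop
  have h2 : ContDiff ℝ (⊤ : ℕ∞) fun p : SpaceTime d => expNegInvGlue p.2 :=
    expNegInvGlue.contDiff.comp contDiff_snd
  exact ((Complex.contDiff_exp (𝕜 := ℝ)).comp
    (contDiff_const.mul (Complex.ofRealCLM.contDiff.comp h1))).mul
    (Complex.ofRealCLM.contDiff.comp h2)

lemma futureWave_add (v x : Fin d → ℝ) (p : SpaceTime d) :
    futureWave v (p + (x, 0)) =
      Complex.exp (2 * Real.pi * Complex.I * (∑ k, v k * x k : ℝ)) * futureWave v p := by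
  simp only [futureWave, Prod.fst_add, Prod.snd_add, add_zero, Pi.add_apply, mul_add,
    Finset.sum_add_distrib, Complex.ofReal_add, Complex.exp_add]
  ring

/-- The distribution given by the wave `exp (2 π i v · x) θ(t)`. -/
def waveDistr (v : Fin d → ℝ) : Distr (SpaceTime d) :=
  (TestFunction.integralAgainstBilinCLM (ContinuousLinearMap.lsmul ℝ ℝ) volume (futureWave v) :
    Test (SpaceTime d) →L[ℝ] ℂ)

lemma waveDistr_apply (v : Fin d → ℝ) (Φ : Test (SpaceTime d)) :
    waveDistr v Φ = ∫ p, Φ p • futureWave v p := by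
  refine (TestFunction.integralAgainstBilinCLM_eq_integral ?_).trans rfl
  exact (contDiff_futureWave v).continuous.locallyIntegrable.locallyIntegrableOn _

lemma waveDistr_ne_zero (v : Fin d → ℝ) : waveDistr v ≠ 0 := by
  intro h0
  have h1 := ae_eq_zero_of_integral_contDiff_smul_eq_zero
    (μ := (volume : Measure (SpaceTime d)))
    (contDiff_futureWave v).continuous.locallyIntegrable fun g hg hg' => by
      let Φ : Test (SpaceTime d) := ⟨g, hg, hg', by simp⟩
      have := waveDistr_apply v Φ
      rw [h0] at this
      exact this.symm
  have h2 : futureWave v = 0 :=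
    (contDiff_futureWave v).continuous.ae_eq_iff_eq _ continuous_zero |>.1 h1
  have h3 := congrFun h2 (0, 1)
  rw [futureWave, Pi.zero_apply, mul_eq_zero, Complex.ofReal_eq_zero] at h3
  exact h3.elim (Complex.exp_ne_zero _) (expNegInvGlue.pos_of_pos one_pos).ne'

lemma translateDistr_waveDistr (v x : Fin d → ℝ) :
    translateDistr ((x, 0) : SpaceTime d) (waveDistr v) =
      Complex.exp (2 * Real.pi * Complex.I * (∑ k, v k * (-x) k : ℝ)) • waveDistr v := by
  ext Φ
  change waveDistr v (translateTest _ Φ) = _ * waveDistr v Φ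
  rw [waveDistr_apply, waveDistr_apply, ← integral_const_mul,
    ← integral_add_right_eq_self _ ((-x, 0) : SpaceTime d)]
  refine integral_congr_ae (.of_forall fun p => ?_)
  simp only [translateTest_apply]
  have hp : p + ((-x, 0) : SpaceTime d) + (x, 0) = p := by
    ext <;> simp
  rw [futureWave_add, mul_smul_comm, hp]

/-- The distributions `w` that vanish for `t < 0` and behave like the wave `exp (2 π i v · x)` under
the translations of space. -/
def modeSpace (v : Fin d → ℝ) : Submodule ℂ (Distr (SpaceTime d)) where
  carrier := {w | (∀ x, translateDistr ((x, 0) : SpaceTime d) w =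
      Complex.exp (2 * Real.pi * Complex.I * (∑ k, v k * (-x) k : ℝ)) • w) ∧
    Distribution.IsVanishingOn w {p : SpaceTime d | p.2 < 0}}
  add_mem' := by
    rintro w w' ⟨h1, h2⟩ ⟨h1', h2'⟩
    refine ⟨fun x => ?_, fun Φ hΦ => ?_⟩
    · rw [smul_add, ← h1, ← h1']
      rfl
    · change w Φ + w' Φ = 0
      rw [h2 Φ hΦ, h2' Φ hΦ, add_zero]
  zero_mem' := ⟨fun x => by ext Φ; exact (mul_zero _).symm, fun Φ _ => rfl⟩
  smul_mem' := by
    rintro c w ⟨h1, h2⟩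
    refine ⟨fun x => ?_, fun Φ hΦ => ?_⟩
    · rw [smul_comm, ← h1]
      rfl
    · change c * w Φ = 0
      rw [h2 Φ hΦ, mul_zero]

lemma mem_modeSpace {v : Fin d → ℝ} {w : Distr (SpaceTime d)} : w ∈ modeSpace v ↔
    (∀ x, translateDistr ((x, 0) : SpaceTime d) w =
      Complex.exp (2 * Real.pi * Complex.I * (∑ k, v k * (-x) k : ℝ)) • w) ∧
    Distribution.IsVanishingOn w {p : SpaceTime d | p.2 < 0} := Iff.rfl

lemma lineDerivOp_smul_distr (b : SpaceTime d) (c : ℂ) (w : Distr (SpaceTime d)) :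
    (∂_{b} (c • w) : Distr (SpaceTime d)) = c • ∂_{b} w := by
  ext Φ
  exact (smul_neg c (w (∂_{b} Φ))).symm

lemma lineDerivOp_mem_modeSpace {v : Fin d → ℝ} {w : Distr (SpaceTime d)} (hw : w ∈ modeSpace v)
    (b : SpaceTime d) : (∂_{b} w : Distr (SpaceTime d)) ∈ modeSpace v := by
  rw [mem_modeSpace] at hw ⊢
  refine ⟨fun x => ?_, hw.2.lineDerivOp b⟩
  rw [translateDistr_lineDerivOp, hw.1, lineDerivOp_smul_distr]

lemma lineDerivOp_space_of_mem_modeSpace {v : Fin d → ℝ} {w : Distr (SpaceTime d)}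
    (hw : w ∈ modeSpace v) (k : Fin d) :
    (∂_{direction k.castSucc} w : Distr (SpaceTime d)) =
      (2 * Real.pi * Complex.I * (v k : ℝ) : ℂ) • w := by
  ext Φ
  have h1 := hasDerivAt_distr_translateTest w Φ 0 (direction k.castSucc) 0
  have h2 : (fun s : ℝ => w (translateTest (0 + s • (direction k.castSucc : SpaceTime d)) Φ)) =
      fun s : ℝ => Complex.exp (-(2 * Real.pi * Complex.I * v k) * s) * w Φ := by
    ext s
    have h3 : s • (direction k.castSucc : SpaceTime d) = (s • Pi.single k 1, 0) := by
      rw [direction_castSucc, Prod.smul_mk, smul_zero]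
    have h4 := DFunLike.congr_fun ((mem_modeSpace.1 hw).1 (s • Pi.single k 1)) Φ
    rw [zero_add, h3, ← translateDistr_apply, h4]
    change _ * w Φ = _
    congr 2
    simp [Pi.single_apply]
    ring
  rw [h2] at h1
  have h5 := (((Complex.hasDerivAt_exp (-(2 * Real.pi * Complex.I * v k) * (0 : ℝ))).comp
    ((0 : ℝ) : ℂ) ((hasDerivAt_id ((0 : ℝ) : ℂ)).const_mul
      (-(2 * Real.pi * Complex.I * v k)))).comp_ofReal).mul_const (w Φ)
  have h6 := h1.unique h5
  rw [zero_smul, add_zero, translateTest_zero] at h6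
  rw [Distribution.lineDerivOp_apply_apply, map_neg, h6]
  change _ = _ * w Φ
  simp

lemma mem_spatiallyPeriodicDistr_of_mem_modeSpace (ha : LinearIndependent ℝ a) (z : Fin d → ℤ)
    {w : Distr (SpaceTime d)}
    (hw : w ∈ modeSpace ((Matrix.of a)⁻¹.mulVec fun i => (z i : ℝ))) :
    w ∈ spatiallyPeriodicDistr a := by
  refine mem_spatiallyPeriodicDistr_iff.2 fun k => ?_
  have h1 : (Matrix.of a).mulVec ((Matrix.of a)⁻¹.mulVec fun i => (z i : ℝ)) =
      fun i => (z i : ℝ) := by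
    rw [Matrix.mulVec_mulVec, Matrix.mul_nonsing_inv _ (isUnit_det_of_linearIndependent ha),
      Matrix.one_mulVec]
  have h2 := congrFun h1 k
  rw [Matrix.mulVec, dotProduct] at h2
  rw [(mem_modeSpace.1 hw).1]
  have h3 : ∑ i, (Matrix.of a)⁻¹.mulVec (fun i => (z i : ℝ)) i * (-a k) i = -(z k : ℝ) := by
    rw [← h2, ← Finset.sum_neg_distrib]
    refine Finset.sum_congr rfl fun i _ => ?_
    simp [mul_comm]
  have h4 : Complex.exp (2 * Real.pi * Complex.I * ((-(z k : ℝ) : ℝ) : ℂ)) = 1 := by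
    refine Complex.exp_eq_one_iff.2 ⟨-z k, ?_⟩
    push_cast
    ring
  rw [h3, h4, one_smul]

/-- The time derivative of distributions, as a complex-linear map. -/
def timeDeriv : Module.End ℂ (Distr (SpaceTime d)) where
  toFun w := ∂_{direction (Fin.last d)} w
  map_add' w w' := LineDeriv.lineDerivOp_add _ w w'
  map_smul' c w := lineDerivOp_smul_distr _ c w

lemma timeFunctional_aeval_timeDeriv (ψ : Test (Space d)) (q : ℂ[X]) (w : Distr (SpaceTime d)) :
    timeFunctional ψ (aeval timeDeriv q w) = aeval functionalDeriv q (timeFunctional ψ w) := by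
  induction q using Polynomial.induction_on generalizing w with
  | C c => simp
  | add p q hp hq => simp [hp, hq]
  | monomial k c h =>
    rw [pow_succ, ← mul_assoc, map_mul (aeval timeDeriv) _ X, map_mul (aeval functionalDeriv) _ X,
      Module.End.mul_apply, Module.End.mul_apply, h, aeval_X, aeval_X]
    congr 1
    exact timeFunctional_time ψ w

/-- If the rank is deficient at the frequency `v = A⁻¹ z`, the behaviour contains a nonzero wave
`w_j = q_j(∂/∂t) (exp (2 π i v · x) θ(t))`, where `q` is a nonzero polynomial vector with
`M(2 π i v, τ) q(τ) = 0`. That `w ≠ 0` follows from the uniqueness for the equation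
`q_j(D) u = 0`. -/
lemma not_isAutonomous_of_rank (ha : LinearIndependent ℝ a)
    {M : Matrix (Fin m) (Fin n) (MvPolynomial (Fin (d + 1)) ℂ)} {z : Fin d → ℤ}
    (h : ∀ t, (evalMatrix M (fun k => 2 * Real.pi * Complex.I *
      ((Matrix.of a)⁻¹.mulVec (fun i => (z i : ℝ)) k : ℝ)) t).rank ≠ n) :
    ¬ IsAutonomous (behaviour (spatiallyPeriodicDistr a) M) := by
  intro haut
  set v : Fin d → ℝ := (Matrix.of a)⁻¹.mulVec fun i => (z i : ℝ) with hv
  simp only [← map_specialize_eval] at h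
  obtain ⟨q, hq, hN⟩ := exists_mulVec_eq_zero_of_rank_ne h
  have hu : waveDistr v ∈ modeSpace v := by
    refine mem_modeSpace.2 ⟨translateDistr_waveDistr v, fun Φ hΦ => ?_⟩
    rw [waveDistr_apply]
    refine integral_eq_zero_of_ae (.of_forall fun p => ?_)
    by_cases hp : p ∈ tsupport Φ
    · have hp' : p.2 < 0 := hΦ hp
      simp [futureWave, expNegInvGlue.zero_of_nonpos hp'.le]
    · simp [image_eq_zero_of_notMem_tsupport hp]
  have hmem : ∀ q : ℂ[X], aeval timeDeriv q (waveDistr v) ∈ modeSpace v := fun q =>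
    aeval_apply_smul_mem_of_le_comap hu q timeDeriv fun w hw => lineDerivOp_mem_modeSpace hw _
  have hw0 := haut (fun j => aeval timeDeriv (q j) (waveDistr v))
    ⟨fun j => mem_spatiallyPeriodicDistr_of_mem_modeSpace ha z (hmem (q j)), fun i => ?_⟩
    fun j => (mem_modeSpace.1 (hmem (q j))).2
  · obtain ⟨j, hj⟩ := Function.ne_iff.1 hq
    refine waveDistr_ne_zero v (distr_eq_zero_of_tensorTest _ fun φ ψ => ?_)
    have h1 := timeFunctional_aeval_timeDeriv ψ (q j) (waveDistr v)
    rw [congrFun hw0 j, Pi.zero_apply, map_zero] at h1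
    have h2 := (vanishesOnPast_timeFunctional ψ (mem_modeSpace.1 hu).2).eq_zero_of_aeval_eq_zero
      hj h1.symm
    exact DFunLike.congr_fun h2 φ
  · have h1 : ∀ j, diffOp (M i j) (aeval timeDeriv (q j) (waveDistr v)) =
        aeval timeDeriv (specialize (fun k => 2 * Real.pi * Complex.I * (v k : ℝ)) (M i j) * q j)
          (waveDistr v) := fun j => by
      rw [map_mul, Module.End.mul_apply]
      exact map_diffOp (P := modeSpace v) (fun w hw i => lineDerivOp_mem_modeSpace hw _)
        LinearMap.id timeDeriv (fun w hw k => lineDerivOp_space_of_mem_modeSpace hw k)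
        (fun w _ => rfl) (M i j) (hmem (q j))
    simp only [h1]
    rw [← LinearMap.sum_apply, ← map_sum]
    have h2 := congrFun hN i
    rw [Matrix.mulVec, dotProduct] at h2
    simp only [Matrix.map_apply, Pi.zero_apply] at h2
    rw [h2, map_zero, LinearMap.zero_apply]

end Waves

end PeriodicBehaviour

end

theorem theorem1 (d m n : ℕ) (a : Fin d → Fin d → ℝ) (ha : LinearIndependent ℝ a)
    (M : Matrix (Fin m) (Fin n) (MvPolynomial (Fin (d + 1)) ℂ)) :
    PeriodicBehaviour.IsAutonomous
        (PeriodicBehaviour.behaviour (PeriodicBehaviour.spatiallyPeriodicDistr a) M) ↔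
      ∀ v ∈ Set.range (fun z : Fin d → ℤ => (Matrix.of a)⁻¹.mulVec (fun k => (z k : ℝ))),
        IsGreatest
          (Set.range fun t : ℂ =>
            (PeriodicBehaviour.evalMatrix M
              (fun k => 2 * Real.pi * Complex.I * (v k : ℂ)) t).rank)
          n := by
  rw [Set.forall_mem_range]
  constructor
  · intro h z
    refine ⟨?_, ?_⟩
    · by_contra h0
      exact PeriodicBehaviour.not_isAutonomous_of_rank ha (fun t ht => h0 ⟨t, ht⟩) h
    · rintro _ ⟨t, rfl⟩
      exact Matrix.rank_le_width _
  · exact fun h => PeriodicBehaviour.isAutonomous_of_rank ha fun z => (h z).1
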